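/- **Notation.** For $\alpha\in\mathbb C$ with $-\pi<\arg\alpha<\pi$ let $$S(\alpha)=-\frac1{8\pi^2}\lim_{X\to\infty}\int_0^X\frac{e^{-is}}{s^3}\Big\{2\sqrt{\pi\alpha}\,s\,\coth(2\sqrt{\pi\alpha}\,s)-1-\frac{4\pi\alpha s^2}{3}\Big\}\,ds ,$$ and for $\mathrm{Re}\,\beta>0$ let $\Phi(\beta)=S(\beta^2)$ and $\overline\Phi(\overline\beta):=\overline{\Phi(\overline\beta)}$. For $n\ge2$ let $$a_n=\frac{1}{8\pi^2}(-16\pi)^nB_{2n}\frac{(2n-3)!}{(2n)!}$$ with $B_{2n}$ the Bernoulli numbers, and let $$B(t)=\frac{2\sqrt\pi\,t\cot(2\sqrt\pi\,t)-1+4\pi t^2/3}{8\pi^2t^3},\qquad B(0)=0 .$$ *Boundary values.* For a function $G$ on the part of the open upper half-plane near $[0,\infty)$, the distribution $G(t+i0)$, $t\ge0$, is the distribution $T$ on $\mathbb R$, supported in $[0,\infty)$, with $\langle T,\varphi\rangle=\lim_{\varepsilon\to0+}\int_0^\infty G(t+i\varepsilon)\varphi(t)\,dt$ for all $\varphi\in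 C_c^\infty(\mathbb R)$, if such a $T$ exists; and $PP(G(t))=\frac12\{G(t+i0)+\overline{G(t+i0)}\}$. For a distribution $T$ supported in $[0,\infty)$, $\int_0^\infty T(t)e^{-t/z}dt$ is said to converge to $L$ if $\langle T,\chi_ke^{-t/z}\rangle\to L$ for every sequence $\chi_k\in C_c^\infty(\mathbb R)$ that is bounded uniformly in $k$ together with each derivative and is eventually equal to $1$ on every bounded interval. *Distributional Borel summability.* Let $C_R=\{z:\mathrm{Re}\,z^{-1}>R^{-1}\}$. Let $\sum_n c_nz^n$ be a formal power series whose Borel transform $\sum_n c_nt^n/n!$ has a positive radius of convergence and has an analytic continuation $G$ to the intersection of a neighbourhood of $[0,\infty)$ with the open upper half-plane, such that $G(t+i0)$, $t\ge0$, exists. If $z^{-1}\int_0^\infty PP(G(t))e^{-t/z}dt$ converges to $f(z)$ for all $z\in C_R$, the series is *Borel summable in the distributional sense* to $f$ on $C_R$; if $z^{-1}\int_0^\infty G(t+i0)e^{-t/z}dt$ converges to $\Psi(z)$ for all $z\in C_R$, $\Psi$ is the *upper sum* of the series on $C_R$. **Statement.** The limit defining $\Phi(\beta)$ exists for $\mathrm{Re}\,\beta>0$,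 and for $0<\arg\beta<\pi/2$ $$\Phi(\beta)=\frac1{8\pi^2}\int_0^\infty\frac{e^{-t}}{t^3}\Big[2\sqrt\pi\,\beta t\cot(2\sqrt\pi\,\beta t)-1+\frac{4\pi\beta^2t^2}{3}\Big]dt ,$$ the integral being absolutely convergent. The function $B$ is the Borel transform of $\sum_{n\ge2}a_n\beta^{2n-3}$, continued analytically. The boundary value distributions $B(t+i0)$ and $PP(B(t))$, $t\ge0$, exist, the latter being also the boundary value of $\mathrm{Re}\,B$. The integrals $$F(\beta)=\frac1\beta\int_0^\infty B(t+i0)e^{-t/\beta}\,dt,\qquad f(\beta)=\frac1\beta\int_0^\infty PP(B(t))e^{-t/\beta}\,dt$$ converge for all $\beta$ with $\mathrm{Re}\,\beta>0$; $F$ is analytic there, and for all such $\beta$ (in particular for $0<\arg\beta<\pi/2$) $$F(\beta)=\beta^{-3}\Phi(\beta),\qquad f(\beta)=\tfrac12\big\{\beta^{-3}\Phi(\beta)+\overline{\overline\beta^{\,-3}\,\Phi(\overline\beta)}\big\}.$$ Equivalently, for every $R>0$ the series $\sum_{n\ge2}a_n\beta^{2n-3}$ is Borel summable in the distributional sense on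 $C_R$ to $f$, with upper sum $\beta^{-3}\Phi(\beta)$. Moreover, for every $R>0$ the series $\sum_{n\ge2}a_n\beta^{2n}$ is Borel summable in the distributional sense on $C_R$ to $\beta^3f(\beta)$, with upper sum $\Phi(\beta)$, and $\beta^3f(\beta)=\frac12\{\Phi(\beta)+\overline\Phi(\overline\beta)\}$ for all $\beta$ with $\mathrm{Re}\,\beta>0$. -/

import Mathlib

open Filter Topology Complex MeasureTheory TopologicalSpace
open scoped Distributions ContDiff ComplexConjugate

noncomputable section

namespace VacPol

/-! ### Distributions on the closed half-line and their Laplace integrals -/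

/-- Complex distributions on the real line (Mathlib's distributions: continuous real-linear maps
on real test functions, with complex values). -/
abbrev Distr : Type := 𝓓'((⊤ : Opens ℝ), ℂ)

/-- The complex-linear extension of a distribution to complex-valued test functions,
`⟨T, ψ⟩ = ⟨T, Re ψ⟩ + i ⟨T, Im ψ⟩`. -/
def pairing (T : Distr) (ψ : 𝓓((⊤ : Opens ℝ), ℂ)) : ℂ :=
  T (TestFunction.postcompCLM Complex.reCLM ψ) +
    I * T (TestFunction.postcompCLM Complex.imCLM ψ)

/-- The complex conjugate of a distribution. -/
def conjDistr (T : Distr) : Distr :=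
  Distribution.mapCLM (Complex.conjCLE : ℂ →L[ℝ] ℂ) T

/-- If `T = B(t + i0)`, this is `PP(B(t)) = (B(t + i0) + conj (B(t + i0))) / 2`. -/
def principalPart (T : Distr) : Distr :=
  (1 / 2 : ℝ) • (T + conjDistr T)

/-- `T` is the boundary value distribution `B(t + i0)`, `t ≥ 0`, of the function `B` defined in the
upper half-plane near the half-line: `⟨T, φ⟩ = lim_{ε → 0+} ∫_0^∞ B(t + iε) φ(t) dt` for all test
functions `φ`, which need not vanish near `t = 0`. So `T` is supported in `[0, ∞)`. -/
def IsBoundaryValue (B : ℂ → ℂ) (T : Distr) : Prop :=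
  ∀ φ : 𝓓((⊤ : Opens ℝ), ℝ),
    (∀ᶠ ε : ℝ in 𝓝[>] 0,
      IntegrableOn (fun t : ℝ => B (t + ε * I) * (φ t : ℂ)) (Set.Ioi 0)) ∧
    Tendsto (fun ε : ℝ => ∫ t in Set.Ioi (0 : ℝ), B (t + ε * I) * (φ t : ℂ))
      (𝓝[>] 0) (𝓝 (T φ))

/-- Approximate units: sequences of test functions, bounded together with each derivative
uniformly in the sequence index, and eventually equal to `1` on every bounded interval. -/
structure IsApproxUnit (χ : ℕ → 𝓓((⊤ : Opens ℝ), ℝ)) : Prop where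
  bounded : ∀ n : ℕ, ∃ M : ℝ, ∀ (k : ℕ) (t : ℝ), |iteratedDeriv n (χ k) t| ≤ M
  eventually_one : ∀ r : ℝ, ∀ᶠ k in atTop, ∀ t : ℝ, |t| ≤ r → χ k t = 1

/-- The test function `t ↦ χ(t) e^{-t/z}`. -/
def expTest (χ : 𝓓((⊤ : Opens ℝ), ℝ)) (z : ℂ) : 𝓓((⊤ : Opens ℝ), ℂ) where
  toFun t := (χ t : ℂ) * Complex.exp (-(t : ℂ) / z)
  contDiff' := by
    have h1 : ContDiff ℝ ∞ fun t : ℝ => (t : ℂ) := Complex.ofRealCLM.contDiff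
    have h2 : ContDiff ℝ ∞ fun t : ℝ => ((χ t : ℝ) : ℂ) :=
      Complex.ofRealCLM.contDiff.comp χ.contDiff
    exact h2.mul ((h1.neg.div_const z).cexp)
  hasCompactSupport' :=
    (χ.hasCompactSupport.comp_left (g := fun x : ℝ => (x : ℂ)) Complex.ofReal_zero).mul_right
  tsupport_subset' := by simp

/-- The integral `∫ T(t) e^{-t/z} dt` of the distribution `e^{-t/z} T` converges to `L`: the usual
notion for integrable distributions, `⟨T, χ_k e^{-t/z}⟩ → L` for every approximate unit `χ_k`. -/
def HasLaplaceIntegral (T : Distr) (z L : ℂ) : Prop :=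
  ∀ χ : ℕ → 𝓓((⊤ : Opens ℝ), ℝ), IsApproxUnit χ →
    Tendsto (fun k => pairing T (expTest (χ k) z)) atTop (𝓝 L)

/-- The Laplace-Borel integral `z⁻¹ ∫_0^∞ T(t) e^{-t/z} dt` of a distribution supported in
`[0, ∞)` converges and has the value `w`. -/
def HasLaplaceBorel (T : Distr) (z w : ℂ) : Prop :=
  ∃ L : ℂ, HasLaplaceIntegral T z L ∧ w = z⁻¹ * L

/-! ### Distributional Borel summability -/

/-- The disk `C_R = {z : Re z⁻¹ > R⁻¹}`. -/
def borelDisk (R : ℝ) : Set ℂ := {z | R⁻¹ < (z⁻¹).re}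

/-- The Borel transform `∑ cₙ tⁿ / n!` of the formal power series `∑ cₙ zⁿ` has a positive radius
of convergence, and `B` is its analytic continuation to the intersection of a neighbourhood of
`[0, ∞)` with the open upper half-plane. -/
def IsBorelContinuation (c : ℕ → ℂ) (B : ℂ → ℂ) : Prop :=
  ∃ ρ : ℝ, 0 < ρ ∧ ∃ U : Set ℂ, IsOpen U ∧ (∀ t : ℝ, 0 ≤ t → (t : ℂ) ∈ U) ∧
    (∀ t ∈ Metric.ball (0 : ℂ) ρ, HasSum (fun n : ℕ => c n / (n.factorial : ℂ) * t ^ n) (B t)) ∧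
    DifferentiableOn ℂ B (Metric.ball (0 : ℂ) ρ ∪ (U ∩ {t | 0 < t.im}))

/-- `∑ cₙ zⁿ` is Borel summable in the distributional sense to `f` on `C_R`. -/
def IsDistributionalBorelSum (c : ℕ → ℂ) (f : ℂ → ℂ) (R : ℝ) : Prop :=
  0 < R ∧ ∃ (B : ℂ → ℂ) (T : Distr), IsBorelContinuation c B ∧ IsBoundaryValue B T ∧
    ∀ z ∈ borelDisk R, HasLaplaceBorel (principalPart T) z (f z)

/-- `Φ` is the upper sum of `∑ cₙ zⁿ` on `C_R`. -/
def IsUpperSum (c : ℕ → ℂ) (Φ : ℂ → ℂ) (R : ℝ) : Prop :=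
  0 < R ∧ ∃ (B : ℂ → ℂ) (T : Distr), IsBorelContinuation c B ∧ IsBoundaryValue B T ∧
    ∀ z ∈ borelDisk R, HasLaplaceBorel T z (Φ z)

/-! ### Vacuum polarization by a uniform electric field -/

/-- The integrand of the effective action; `2 √(π α) s` is evaluated with the principal root. -/
def actionIntegrand (α : ℂ) (s : ℝ) : ℂ :=
  Complex.exp (-(I * s)) / (s : ℂ) ^ 3 *
    (2 * ((Real.pi : ℂ) * α) ^ (1 / 2 : ℂ) * s *
        (Complex.cosh (2 * ((Real.pi : ℂ) * α) ^ (1 / 2 : ℂ) * s) /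
          Complex.sinh (2 * ((Real.pi : ℂ) * α) ^ (1 / 2 : ℂ) * s))
      - 1 - 4 * Real.pi * α * (s : ℂ) ^ 2 / 3)

/-- `-(1 / 8π²)` times the integral of `actionIntegrand α` over `[0, X]`. -/
def actionPartial (α : ℂ) (X : ℝ) : ℂ :=
  -(1 / (8 * (Real.pi : ℂ) ^ 2)) * ∫ s in (0 : ℝ)..X, actionIntegrand α s

/-- The effective action `S(α)`, `|arg α| < π`: a conditionally convergent improper integral. -/
def action (α : ℂ) : ℂ := limUnder atTop (actionPartial α)

/-- `Φ(β) = S(β²)`. -/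
def Phi (β : ℂ) : ℂ := action (β ^ 2)

/-- The coefficients `aₙ`, `n ≥ 2`, of the perturbation expansion. -/
def coeffA (n : ℕ) : ℂ :=
  1 / (8 * (Real.pi : ℂ) ^ 2) * (-16 * (Real.pi : ℂ)) ^ n * ((bernoulli (2 * n) : ℚ) : ℂ) *
    ((2 * n - 3).factorial : ℂ) / ((2 * n).factorial : ℂ)

/-- The formal power series `∑_{n ≥ 2} aₙ β^{2n-3}`. -/
def seriesShifted (m : ℕ) : ℂ := if Odd m then coeffA ((m + 3) / 2) else 0

/-- The formal power series `∑_{n ≥ 2} aₙ β^{2n}`. -/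
def seriesFull (m : ℕ) : ℂ := if Even m ∧ 4 ≤ m then coeffA (m / 2) else 0

/-- `B(t) = (2√π t cot(2√π t) - 1 + 4π t² / 3) / (8π² t³)`; at the removable singularity `t = 0`
the conventions for division by zero give the correct value `B(0) = 0`. -/
def borelB (t : ℂ) : ℂ :=
  (2 * (Real.sqrt Real.pi : ℂ) * t * Complex.cot (2 * (Real.sqrt Real.pi : ℂ) * t) - 1
      + 4 * Real.pi * t ^ 2 / 3) / (8 * (Real.pi : ℂ) ^ 2 * t ^ 3)

/-- The integrand of the rotated representation of `Φ(β)`, `0 < arg β < π/2`. -/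
def rotatedIntegrand (β : ℂ) (t : ℝ) : ℂ :=
  Complex.exp (-(t : ℂ)) / (t : ℂ) ^ 3 *
    (2 * (Real.sqrt Real.pi : ℂ) * β * t *
        Complex.cot (2 * (Real.sqrt Real.pi : ℂ) * β * t)
      - 1 + 4 * Real.pi * β ^ 2 * (t : ℂ) ^ 2 / 3)

end VacPol

end

/-!
The subtracted terms in `B` remove its pole at `0` and leave a sum of simple poles at nonzero real
points, with summable residues. Its third primitive with a triple zero at `0` is the Borel
transform of `∑ aₙ β^{2n}`; a pole at `x` becomes a singularity `(t - x)² log (t - x)`, so this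
primitive extends continuously from the upper half-plane to `[0, ∞)` and grows at most
cubically. Hence `B(t + i0)` is the third distributional derivative of a continuous function. As
the primitives vanish at `0`, integration by parts turns each derivative into a factor `β⁻¹` of the
Laplace-Borel integral, and everything reduces to the absolutely convergent integral of the third
primitive. Its ray of integration can be rotated into the open upper half-plane, where `B` is
`O(1/t)` on sectors, and the rotation can be pushed to the ray `t = iβs`, on which `cot` becomes
`coth` and the integral converges only conditionally: this is the integral defining `Φ(β)`.
-/

noncomputable section

namespace VacPol

/-! ### The third primitive of a simple pole -/

/-- `w log w`, with the branch of the logarithm that is continuous from below on the cut. -/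
def mulLog (w : ℂ) : ℂ := -(w * log w⁻¹)

lemma mulLog_of_mem_slitPlane {w : ℂ} (hw : w ∈ slitPlane) : mulLog w = w * log w := by
  rw [mulLog, log_inv _ (slitPlane_arg_ne_pi hw), mul_neg, neg_neg]

lemma norm_mulLog_le (w : ℂ) : ‖mulLog w‖ ≤ ‖w‖ * |Real.log ‖w‖| + Real.pi * ‖w‖ := by
  have hlog : ‖log w⁻¹‖ ≤ |Real.log ‖w‖| + Real.pi := by
    refine (norm_le_abs_re_add_abs_im _).trans (add_le_add ?_ ?_)
    · rw [log_re, norm_inv, Real.log_inv, abs_neg]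
    · exact log_im w⁻¹ ▸ abs_arg_le_pi _
  rw [mulLog, norm_neg, norm_mul]
  linarith [mul_le_mul_of_nonneg_left hlog (norm_nonneg w)]

lemma hasDerivAt_mulLog {w : ℂ} (hw : w ∈ slitPlane) : HasDerivAt mulLog (log w + 1) w := by
  have h : HasDerivAt (fun w => w * log w) (log w + 1) w := by
    simpa [slitPlane_ne_zero hw] using (hasDerivAt_id' w).fun_mul (hasDerivAt_log hw)
  refine h.congr_of_eventuallyEq ?_
  filter_upwards [isOpen_slitPlane.mem_nhds hw] with v hv using mulLog_of_mem_slitPlane hv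

lemma continuousAt_mulLog_zero : ContinuousAt mulLog 0 := by
  have hcont : Continuous fun w : ℂ => |‖w‖ * Real.log ‖w‖| + Real.pi * ‖w‖ :=
    (Real.continuous_mul_log.comp continuous_norm).abs.add (continuous_const.mul continuous_norm)
  have hzero : mulLog 0 = 0 := by simp [mulLog]
  rw [ContinuousAt, hzero]
  refine squeeze_zero_norm norm_mulLog_le ((hcont.tendsto' 0 0 (by simp)).congr fun w => ?_)
  rw [abs_mul, abs_norm]

lemma continuousOn_mulLog : ContinuousOn mulLog {w | w.im ≤ 0} := by
  intro w _
  by_cases hslit : w ∈ slitPlane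
  · exact (hasDerivAt_mulLog hslit).continuousAt.continuousWithinAt
  by_cases h0 : w = 0
  · exact h0 ▸ continuousAt_mulLog_zero.continuousWithinAt
  rw [mem_slitPlane_iff, not_or, not_lt, not_not] at hslit
  have hre : w.re < 0 := lt_of_le_of_ne hslit.1 fun h => h0 (Complex.ext h hslit.2)
  have hlog : ContinuousWithinAt log {z | 0 ≤ z.im} w⁻¹ := by
    refine continuousWithinAt_log_of_re_neg_of_im_zero ?_ ?_
    · rw [inv_re]; exact div_neg_of_neg_of_pos hre (normSq_pos.2 h0)
    · rw [inv_im, hslit.2, neg_zero, zero_div]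
  have hmaps : Set.MapsTo (fun w : ℂ => w⁻¹) {w | w.im ≤ 0} {z | 0 ≤ z.im} := fun v hv => by
    simpa only [Set.mem_ofPred_eq, inv_im] using
      div_nonneg (neg_nonneg.2 hv) (normSq_nonneg v)
  exact (continuousWithinAt_id.mul
    (hlog.comp (continuousAt_inv₀ h0).continuousWithinAt hmaps)).neg

/-- The remainder of `(1 + u)² log (1 + u)` after its Taylor polynomial of degree two. -/
def sqLogRemainder (u : ℂ) : ℂ := (1 + u) * mulLog (1 + u) - u - 3 / 2 * u ^ 2

lemma norm_sqLogRemainder_le_of_le_half {u : ℂ} (hu : ‖u‖ ≤ 1 / 2) :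
    ‖sqLogRemainder u‖ ≤ 2 * ‖u‖ ^ 3 := by
  have hu1 : ‖u‖ < 1 := by linarith
  set r := log (1 + u) - (u - u ^ 2 / 2) with hr
  have hr_le : ‖r‖ ≤ 2 / 3 * ‖u‖ ^ 3 := by
    have h := norm_log_sub_logTaylor_le 2 hu1
    have htaylor : logTaylor 3 u = u - u ^ 2 / 2 := by
      simp [logTaylor, Finset.sum_range_succ]; ring
    have hinv : (1 - ‖u‖)⁻¹ ≤ 2 := by
      rw [inv_le_comm₀ (by linarith) two_pos]; linarith
    rw [htaylor, ← hr] at h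
    norm_num at h
    nlinarith [pow_nonneg (norm_nonneg u) 3]
  have hexpand : sqLogRemainder u = -(u ^ 4 / 2) + (1 + u) ^ 2 * r := by
    rw [sqLogRemainder, mulLog_of_mem_slitPlane (mem_slitPlane_of_norm_lt_one hu1), hr]; ring
  have h1 : ‖1 + u‖ ≤ 3 / 2 := by
    linarith [norm_add_le (1 : ℂ) u, norm_one (α := ℂ)]
  calc ‖sqLogRemainder u‖ ≤ ‖u‖ ^ 4 / 2 + ‖1 + u‖ ^ 2 * ‖r‖ := by
        rw [hexpand]; exact (norm_add_le _ _).trans_eq (by simp)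
    _ ≤ (1 / 2) * ‖u‖ ^ 3 / 2 + (3 / 2) ^ 2 * (2 / 3 * ‖u‖ ^ 3) := by
        rw [pow_succ' ‖u‖ 3]; gcongr
    _ ≤ 2 * ‖u‖ ^ 3 := by linarith [pow_nonneg (norm_nonneg u) 3]

lemma mul_abs_log_le (x : ℝ) (hx : 0 ≤ x) : x * |Real.log x| ≤ 1 + x ^ 2 := by
  rcases hx.eq_or_lt with rfl | hpos
  · norm_num
  rcases le_or_gt x 1 with h1 | h1
  · have h := (Real.abs_log_mul_self_lt x hpos h1).le
    rw [abs_mul, abs_of_pos hpos, mul_comm] at h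
    linarith [sq_nonneg x]
  · rw [abs_of_pos (Real.log_pos h1)]
    nlinarith [Real.log_le_sub_one_of_pos hpos]

lemma norm_sqLogRemainder_le (u : ℂ) : ‖sqLogRemainder u‖ ≤ 120 * ‖u‖ ^ 3 := by
  rcases le_or_gt ‖u‖ (1 / 2) with hu | hu
  · linarith [norm_sqLogRemainder_le_of_le_half hu, pow_nonneg (norm_nonneg u) 3]
  have hw : ‖1 + u‖ ≤ 3 * ‖u‖ := by
    linarith [norm_add_le (1 : ℂ) u, norm_one (α := ℂ)]
  have hmulLog : ‖mulLog (1 + u)‖ ≤ 1 + (3 * ‖u‖) ^ 2 + 4 * (3 * ‖u‖) := by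
    calc ‖mulLog (1 + u)‖ ≤ 1 + ‖1 + u‖ ^ 2 + Real.pi * ‖1 + u‖ :=
          (norm_mulLog_le _).trans (add_le_add_left (mul_abs_log_le _ (norm_nonneg _)) _)
      _ ≤ 1 + (3 * ‖u‖) ^ 2 + 4 * (3 * ‖u‖) := by gcongr; exact Real.pi_lt_four.le
  calc ‖sqLogRemainder u‖ ≤ ‖1 + u‖ * ‖mulLog (1 + u)‖ + ‖u‖ + 3 / 2 * ‖u‖ ^ 2 := by
        refine (norm_sub_le _ _).trans (add_le_add ((norm_sub_le _ _).trans_eq ?_) ?_)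
        · rw [norm_mul]
        · simp
    _ ≤ 3 * ‖u‖ * (1 + (3 * ‖u‖) ^ 2 + 4 * (3 * ‖u‖)) + ‖u‖ + 3 / 2 * ‖u‖ ^ 2 := by gcongr
    _ ≤ 120 * ‖u‖ ^ 3 := by nlinarith [mul_pos (by linarith : 0 < ‖u‖) (by linarith : 0 < ‖u‖)]

/-- The third primitive of `t ↦ (t - a)⁻¹` that vanishes at the origin together with its first two
derivatives; on the cut beyond `a` it takes its boundary value from the upper half-plane if
`a > 0`. -/
def polePrimitive (a : ℝ) (t : ℂ) : ℂ := a ^ 2 / 2 * sqLogRemainder (-(t / a))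

lemma norm_polePrimitive_le {a : ℝ} (ha : a ≠ 0) (t : ℂ) :
    ‖polePrimitive a t‖ ≤ 60 / |a| * ‖t‖ ^ 3 := by
  have : 0 < |a| := abs_pos.2 ha
  calc ‖polePrimitive a t‖ = |a| ^ 2 / 2 * ‖sqLogRemainder (-(t / a))‖ := by
        simp [polePrimitive]
    _ ≤ |a| ^ 2 / 2 * (120 * (‖t‖ / |a|) ^ 3) := by
        gcongr; simpa using norm_sqLogRemainder_le (-(t / a))
    _ = 60 / |a| * ‖t‖ ^ 3 := by field_simp; ring

section Derivatives

variable {a : ℝ} {t : ℂ}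

lemma hasDerivAt_one_sub_div : HasDerivAt (fun t : ℂ => 1 + -(t / a)) (-(a : ℂ)⁻¹) t := by
  simpa [div_eq_mul_inv] using ((hasDerivAt_id t).div_const (a : ℂ)).neg.const_add 1

lemma hasDerivAt_mulLog_one_sub_div (ht : 1 + -(t / a) ∈ slitPlane) :
    HasDerivAt (fun t : ℂ => mulLog (1 + -(t / a))) ((log (1 + -(t / a)) + 1) * -(a : ℂ)⁻¹) t :=
  HasDerivAt.comp (h₂ := mulLog) t (hasDerivAt_mulLog ht) hasDerivAt_one_sub_div

lemma hasDerivAt_polePrimitive (ha : a ≠ 0) (ht : 1 + -(t / a) ∈ slitPlane) :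
    HasDerivAt (polePrimitive a) (-a * mulLog (1 + -(t / a)) - t) t := by
  have hw := hasDerivAt_one_sub_div (a := a) (t := t)
  have hu : HasDerivAt (fun t : ℂ => -(t / a)) (-(a : ℂ)⁻¹) t := by
    simpa using hw.sub_const 1
  convert! (((hw.mul (hasDerivAt_mulLog_one_sub_div ht)).sub hu).sub
    ((hu.pow 2).const_mul (3 / 2))).const_mul ((a : ℂ) ^ 2 / 2) using 1
  have ha' : (a : ℂ) ≠ 0 := ofReal_ne_zero.2 ha
  rw [mulLog_of_mem_slitPlane ht]
  push_cast
  field_simp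
  ring

lemma hasDerivAt_deriv_polePrimitive (ha : a ≠ 0) (ht : 1 + -(t / a) ∈ slitPlane) :
    HasDerivAt (fun t : ℂ => -a * mulLog (1 + -(t / a)) - t) (log (1 + -(t / a))) t := by
  convert! ((hasDerivAt_mulLog_one_sub_div ht).const_mul (-a : ℂ)).sub (hasDerivAt_id t) using 1
  have ha' : (a : ℂ) ≠ 0 := ofReal_ne_zero.2 ha
  field_simp
  ring

lemma hasDerivAt_log_one_sub_div (ha : a ≠ 0) (ht : 1 + -(t / a) ∈ slitPlane) :
    HasDerivAt (fun t : ℂ => log (1 + -(t / a))) (t - a)⁻¹ t := by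
  have ha' : (a : ℂ) ≠ 0 := ofReal_ne_zero.2 ha
  have hsub : t - a = -a * (1 + -(t / a)) := by field_simp; ring
  convert! (hasDerivAt_log ht).comp t hasDerivAt_one_sub_div using 1
  rw [hsub, mul_inv, inv_neg, mul_comm]

lemma eventually_one_sub_div_mem_slitPlane (ht : 1 + -(t / a) ∈ slitPlane) :
    ∀ᶠ s : ℂ in 𝓝 t, 1 + -(s / a) ∈ slitPlane :=
  (by fun_prop : ContinuousAt (fun s : ℂ => 1 + -(s / a)) t).eventually
    (isOpen_slitPlane.mem_nhds ht)

lemma iteratedDeriv_one_polePrimitive (ha : a ≠ 0) (ht : 1 + -(t / a) ∈ slitPlane) :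
    iteratedDeriv 1 (polePrimitive a) t = -a * mulLog (1 + -(t / a)) - t := by
  rw [iteratedDeriv_one, (hasDerivAt_polePrimitive ha ht).deriv]

lemma iteratedDeriv_two_polePrimitive (ha : a ≠ 0) (ht : 1 + -(t / a) ∈ slitPlane) :
    iteratedDeriv 2 (polePrimitive a) t = log (1 + -(t / a)) := by
  rw [iteratedDeriv_succ, ← (hasDerivAt_deriv_polePrimitive ha ht).deriv]
  refine EventuallyEq.deriv_eq ?_
  filter_upwards [eventually_one_sub_div_mem_slitPlane ht] with s hs
    using iteratedDeriv_one_polePrimitive ha hs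

lemma iteratedDeriv_three_polePrimitive (ha : a ≠ 0) (ht : 1 + -(t / a) ∈ slitPlane) :
    iteratedDeriv 3 (polePrimitive a) t = (t - a)⁻¹ := by
  rw [iteratedDeriv_succ, ← (hasDerivAt_log_one_sub_div ha ht).deriv]
  refine EventuallyEq.deriv_eq ?_
  filter_upwards [eventually_one_sub_div_mem_slitPlane ht] with s hs
    using iteratedDeriv_two_polePrimitive ha hs

end Derivatives

lemma iteratedDeriv_polePrimitive_zero {a : ℝ} (ha : a ≠ 0) {j : ℕ} (hj : j < 3) :
    iteratedDeriv j (polePrimitive a) 0 = 0 := by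
  have h0 : 1 + -((0 : ℂ) / a) ∈ slitPlane := by simp
  interval_cases j
  · simp [polePrimitive, sqLogRemainder, mulLog]
  · rw [iteratedDeriv_one_polePrimitive ha h0]; simp [mulLog]
  · rw [iteratedDeriv_two_polePrimitive ha h0]; simp

lemma one_sub_div_mem_slitPlane {a : ℝ} {t : ℂ} (ha : a ≠ 0) (ht : ‖t‖ < |a| ∨ t.im ≠ 0) :
    1 + -(t / a) ∈ slitPlane := by
  rcases ht with ht | ht
  · refine mem_slitPlane_of_norm_lt_one ?_
    rwa [norm_neg, norm_div, norm_real, Real.norm_eq_abs, div_lt_one (abs_pos.2 ha)]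
  · refine mem_slitPlane_iff.2 (Or.inr ?_)
    simpa [div_ofReal_im] using ⟨ht, ha⟩

/-- The closed quadrant whose lower edge carries the boundary values. -/
def closedQuadrant : Set ℂ := {t | 0 ≤ t.re ∧ 0 ≤ t.im}

lemma continuousOn_polePrimitive {a : ℝ} (ha : a ≠ 0) :
    ContinuousOn (polePrimitive a) closedQuadrant := by
  have hw : Continuous fun t : ℂ => 1 + -(t / a) := by fun_prop
  have hlog : ContinuousOn (fun t : ℂ => mulLog (1 + -(t / a))) closedQuadrant := by
    rcases ha.lt_or_gt with ha | ha
    · intro t ht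
      refine ((hasDerivAt_mulLog (mem_slitPlane_iff.2 (Or.inl ?_))).continuousAt.comp
        hw.continuousAt).continuousWithinAt
      have : t.re / a ≤ 0 := div_nonpos_of_nonneg_of_nonpos ht.1 ha.le
      simp only [add_re, one_re, neg_re, div_ofReal_re]
      linarith
    · refine continuousOn_mulLog.comp hw.continuousOn fun t ht => ?_
      simpa [div_ofReal_im] using div_nonneg ht.2 ha.le
  unfold polePrimitive sqLogRemainder
  fun_prop

/-! ### Sums of simple poles on the real line -/

lemma hasDerivAt_iteratedDeriv {f : ℂ → ℂ} {U : Set ℂ} (hf : DifferentiableOn ℂ f U)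
    (hU : IsOpen U) (j : ℕ) {z : ℂ} (hz : z ∈ U) :
    HasDerivAt (iteratedDeriv j f) (iteratedDeriv (j + 1) f z) z := by
  rw [iteratedDeriv_succ, iteratedDeriv_eq_iterate]
  exact ((hf.analyticAt (hU.mem_nhds hz)).iterated_deriv j).differentiableAt.hasDerivAt

lemma hasSum_iteratedDeriv {ι : Type*} {F : ι → ℂ → ℂ} {U : Set ℂ} {u : ι → ℝ} (hu : Summable u)
    (hF : ∀ i, DifferentiableOn ℂ (F i) U) (hU : IsOpen U) (hFu : ∀ i, ∀ w ∈ U, ‖F i w‖ ≤ u i)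
    (j : ℕ) {z : ℂ} (hz : z ∈ U) :
    HasSum (fun i => iteratedDeriv j (F i) z) (iteratedDeriv j (fun w => ∑' i, F i w) z) := by
  have hderiv : ∀ (s : Finset ι) (j : ℕ), Set.EqOn (iteratedDeriv j fun w => ∑ i ∈ s, F i w)
      (fun w => ∑ i ∈ s, iteratedDeriv j (F i) w) U := fun s j w hw =>
    iteratedDeriv_fun_sum fun i _ => ((hF i).analyticAt (hU.mem_nhds hw)).contDiffAt
  have hlim : ∀ j : ℕ, TendstoLocallyUniformlyOn
      (fun s : Finset ι => iteratedDeriv j fun w => ∑ i ∈ s, F i w)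
      (iteratedDeriv j fun w => ∑' i, F i w) atTop U := fun j => by
    induction j with
    | zero =>
      simpa only [iteratedDeriv_zero] using
        (tendstoUniformlyOn_tsum hu hFu).tendstoLocallyUniformlyOn
    | succ j ih =>
      simp only [iteratedDeriv_succ]
      refine ih.deriv (Eventually.of_forall fun s w hw => ?_) hU
      exact (hasDerivAt_iteratedDeriv (.fun_sum fun i _ => hF i) hU j
        hw).differentiableAt.differentiableWithinAt
  exact ((hlim j).tendsto_at hz).congr fun s => hderiv s j hz

lemma iteratedDeriv_zero_eq_of_hasSum {f : ℂ → ℂ} {c : ℕ → ℂ} {r : ℝ} (hr : 0 < r)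
    (hf : ∀ t ∈ Metric.ball (0 : ℂ) r, HasSum (fun n => c n * t ^ n) (f t)) (n : ℕ) :
    iteratedDeriv n f 0 = n.factorial * c n := by
  have hseries : HasFPowerSeriesAt f (.ofScalars ℂ c) 0 := by
    rw [hasFPowerSeriesAt_iff]
    filter_upwards [Metric.ball_mem_nhds (0 : ℂ) hr] with t ht
    simpa [mul_comm] using hf t ht
  have h := congrArg (fun p => p.coeff n)
    (hseries.analyticAt.hasFPowerSeriesAt.eq_formalMultilinearSeries hseries)
  simp only [FormalMultilinearSeries.coeff_ofScalars] at h
  rw [← h, mul_div_cancel₀ _ (Nat.cast_ne_zero.2 n.factorial_ne_zero)]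

lemma isBorelContinuation_of_iteratedDeriv {f : ℂ → ℂ} {c : ℕ → ℂ} {ρ : ℝ} (hρ : 0 < ρ)
    (hf : DifferentiableOn ℂ f (Metric.ball 0 ρ ∪ {t | 0 < t.im}))
    (hc : ∀ n, iteratedDeriv n f 0 = c n) : IsBorelContinuation c f := by
  refine ⟨ρ, hρ, Set.univ, isOpen_univ, fun _ _ => trivial, fun t ht => ?_, by simpa using hf⟩
  convert! hasSum_taylorSeries_on_ball (hf.mono Set.subset_union_left) ht using 1
  ext n
  rw [hc, sub_zero, smul_eq_mul, smul_eq_mul]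
  ring

/-- Real numbers bounded away from the origin, to serve as the simple poles of a meromorphic
function, together with summable residues. -/
structure RealPoles (ι : Type*) where
  /-- The poles. -/
  pos : ι → ℝ
  /-- The residues. -/
  res : ι → ℂ
  /-- A lower bound for the distance of the poles from the origin. -/
  gap : ℝ
  gap_pos : 0 < gap
  gap_le (k : ι) : gap ≤ |pos k|
  summable_norm_res : Summable fun k => ‖res k‖

namespace RealPoles

variable {ι : Type*} (P : RealPoles ι)

/-- The sum of the simple poles. -/
def cauchy (t : ℂ) : ℂ := ∑' k, P.res k * (t - P.pos k)⁻¹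

/-- The third primitive of `P.cauchy`, with a zero of order at least three at the origin. -/
def primitive (t : ℂ) : ℂ := ∑' k, P.res k * polePrimitive (P.pos k) t

/-- The open upper half-plane together with a disk around the origin free of poles. -/
def domain : Set ℂ := Metric.ball 0 P.gap ∪ {t | 0 < t.im}

lemma isOpen_domain : IsOpen P.domain :=
  Metric.isOpen_ball.union (isOpen_lt continuous_const continuous_im)

lemma zero_mem_domain : 0 ∈ P.domain := Or.inl (Metric.mem_ball_self P.gap_pos)

lemma pos_ne_zero (k : ι) : P.pos k ≠ 0 := abs_pos.1 (P.gap_pos.trans_le (P.gap_le k))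

variable {P} in
lemma one_sub_div_pos_mem_slitPlane {t : ℂ} (ht : t ∈ P.domain) (k : ι) :
    1 + -(t / P.pos k) ∈ slitPlane :=
  one_sub_div_mem_slitPlane (P.pos_ne_zero k) <|
    ht.imp (fun h => (mem_ball_zero_iff.1 h).trans_le (P.gap_le k)) ne_of_gt

lemma norm_primitive_term_le (k : ι) (t : ℂ) :
    ‖P.res k * polePrimitive (P.pos k) t‖ ≤ ‖P.res k‖ * (60 / P.gap * ‖t‖ ^ 3) := by
  rw [norm_mul]
  gcongr
  refine (norm_polePrimitive_le (P.pos_ne_zero k) t).trans ?_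
  have := P.gap_pos
  gcongr
  exact P.gap_le k

lemma exists_norm_primitive_le : ∃ K, ∀ t, ‖P.primitive t‖ ≤ K * ‖t‖ ^ 3 := by
  refine ⟨(∑' k, ‖P.res k‖) * (60 / P.gap), fun t => ?_⟩
  rw [mul_assoc, ← tsum_mul_right]
  exact tsum_of_norm_bounded (P.summable_norm_res.mul_right _).hasSum
    fun k => P.norm_primitive_term_le k t

lemma norm_primitive_term_le_of_le {t : ℂ} {r : ℝ} (ht : ‖t‖ ≤ r) (k : ι) :
    ‖P.res k * polePrimitive (P.pos k) t‖ ≤ ‖P.res k‖ * (60 / P.gap * r ^ 3) := by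
  have := P.gap_pos
  exact (P.norm_primitive_term_le k t).trans (by gcongr)

lemma continuousOn_primitive : ContinuousOn P.primitive closedQuadrant := by
  intro t ht
  have hball : Metric.ball (0 : ℂ) (‖t‖ + 1) ∈ 𝓝 t :=
    Metric.isOpen_ball.mem_nhds (by simp)
  have h : ContinuousOn P.primitive (closedQuadrant ∩ Metric.ball 0 (‖t‖ + 1)) :=
    continuousOn_tsum (fun k => continuousOn_const.mul
        ((continuousOn_polePrimitive (P.pos_ne_zero k)).mono Set.inter_subset_left))
      (P.summable_norm_res.mul_right (60 / P.gap * (‖t‖ + 1) ^ 3))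
      (fun k s hs => P.norm_primitive_term_le_of_le (mem_ball_zero_iff.1 hs.2).le k)
  exact (h t ⟨ht, mem_of_mem_nhds hball⟩).mono_of_mem_nhdsWithin
    (inter_mem self_mem_nhdsWithin (mem_nhdsWithin_of_mem_nhds hball))

lemma differentiableOn_primitive_term (k : ι) :
    DifferentiableOn ℂ (fun t => P.res k * polePrimitive (P.pos k) t) P.domain := fun _ ht =>
  ((hasDerivAt_polePrimitive (P.pos_ne_zero k)
    (one_sub_div_pos_mem_slitPlane ht k)).differentiableAt.const_mul _).differentiableWithinAt

variable {P} in
lemma hasSum_iteratedDeriv_primitive (j : ℕ) {t : ℂ} (ht : t ∈ P.domain) :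
    HasSum (fun k => P.res k * iteratedDeriv j (polePrimitive (P.pos k)) t)
      (iteratedDeriv j P.primitive t) := by
  have hball : t ∈ P.domain ∩ Metric.ball 0 (‖t‖ + 1) := ⟨ht, by simp⟩
  have h := hasSum_iteratedDeriv (P.summable_norm_res.mul_right (60 / P.gap * (‖t‖ + 1) ^ 3))
    (fun k => (P.differentiableOn_primitive_term k).mono Set.inter_subset_left)
    (P.isOpen_domain.inter Metric.isOpen_ball)
    (fun k s hs => P.norm_primitive_term_le_of_le (mem_ball_zero_iff.1 hs.2).le k) j hball
  simp only [iteratedDeriv_const_mul_field] at h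
  exact h

lemma differentiableOn_primitive : DifferentiableOn ℂ P.primitive P.domain := fun t ht => by
  have hball : P.domain ∩ Metric.ball 0 (‖t‖ + 1) ∈ 𝓝 t :=
    (P.isOpen_domain.inter Metric.isOpen_ball).mem_nhds ⟨ht, by simp⟩
  have h := differentiableOn_tsum_of_summable_norm
    (P.summable_norm_res.mul_right (60 / P.gap * (‖t‖ + 1) ^ 3))
    (fun k => (P.differentiableOn_primitive_term k).mono Set.inter_subset_left)
    (P.isOpen_domain.inter Metric.isOpen_ball)
    (fun k s hs => P.norm_primitive_term_le_of_le (mem_ball_zero_iff.1 hs.2).le k)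
  exact (h.differentiableAt hball).differentiableWithinAt

variable {P} in
lemma hasSum_cauchy {t : ℂ} (ht : t ∈ P.domain) :
    HasSum (fun k => P.res k * (t - P.pos k)⁻¹) (iteratedDeriv 3 P.primitive t) := by
  simpa only [iteratedDeriv_three_polePrimitive (P.pos_ne_zero _)
    (one_sub_div_pos_mem_slitPlane ht _)] using hasSum_iteratedDeriv_primitive 3 ht

lemma iteratedDeriv_three_primitive : Set.EqOn (iteratedDeriv 3 P.primitive) P.cauchy P.domain :=
  fun _ ht => (hasSum_cauchy ht).tsum_eq.symm

lemma iteratedDeriv_primitive_zero {j : ℕ} (hj : j < 3) : iteratedDeriv j P.primitive 0 = 0 := by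
  rw [← (hasSum_iteratedDeriv_primitive j P.zero_mem_domain).tsum_eq]
  simp [iteratedDeriv_polePrimitive_zero (P.pos_ne_zero _) hj]

lemma differentiableOn_cauchy : DifferentiableOn ℂ P.cauchy P.domain := fun _ ht =>
  ((hasDerivAt_iteratedDeriv P.differentiableOn_primitive P.isOpen_domain 3
    ht).differentiableAt.differentiableWithinAt).congr
    (fun _ hs => (P.iteratedDeriv_three_primitive hs).symm)
    (P.iteratedDeriv_three_primitive ht).symm

section Sector

variable {s : ℝ} {t : ℂ}

lemma mul_norm_le_norm_sub_ofReal (ht : s * ‖t‖ ≤ t.im) (a : ℝ) : s * ‖t‖ ≤ ‖t - a‖ := by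
  have him : t.im ≤ ‖t - a‖ := by simpa using (le_abs_self _).trans (abs_im_le_norm (t - a))
  exact ht.trans him

lemma mul_abs_le_norm_sub_ofReal (hs : 0 < s) (hs1 : s ≤ 1) (ht : s * ‖t‖ ≤ t.im) (a : ℝ) :
    s * |a| ≤ ‖t - a‖ := by
  rcases eq_or_ne t 0 with rfl | h0
  · simpa using mul_le_of_le_one_left (abs_nonneg a) hs1
  have hnorm : 0 < ‖t‖ := norm_pos_iff.2 h0
  have him : 0 ≤ t.im := (by positivity : 0 ≤ s * ‖t‖).trans ht
  have harea : (conj t * (t - a)).im = a * t.im := by simp [mul_im]; ring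
  have h : |a| * t.im ≤ ‖t‖ * ‖t - a‖ := by
    have := abs_im_le_norm (conj t * (t - a))
    rwa [harea, abs_mul, abs_of_nonneg him, norm_mul, norm_conj] at this
  refine le_of_mul_le_mul_left ?_ hnorm
  linarith [mul_le_mul_of_nonneg_left ht (abs_nonneg a)]

lemma norm_cauchy_le {b : ℝ} (hb : 0 < b) (ht : ∀ k, b ≤ ‖t - P.pos k‖) :
    ‖P.cauchy t‖ ≤ (∑' k, ‖P.res k‖) * b⁻¹ := by
  rw [← tsum_mul_right]
  refine tsum_of_norm_bounded (P.summable_norm_res.mul_right _).hasSum fun k => ?_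
  rw [norm_mul, norm_inv]
  gcongr
  exact ht k

lemma norm_cauchy_le_of_mul_norm_le_im (hs : 0 < s) (hs1 : s ≤ 1) (ht : s * ‖t‖ ≤ t.im) :
    ‖P.cauchy t‖ ≤ (∑' k, ‖P.res k‖) * (s * P.gap)⁻¹ :=
  P.norm_cauchy_le (mul_pos hs P.gap_pos) fun k =>
    (mul_le_mul_of_nonneg_left (P.gap_le k) hs.le).trans (mul_abs_le_norm_sub_ofReal hs hs1 ht _)

lemma norm_cauchy_mul_norm_le (hs : 0 < s) (ht : s * ‖t‖ ≤ t.im) :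
    ‖P.cauchy t‖ * ‖t‖ ≤ (∑' k, ‖P.res k‖) * s⁻¹ := by
  rcases eq_or_ne t 0 with rfl | h0
  · simpa using mul_nonneg (tsum_nonneg fun k => norm_nonneg (P.res k)) (inv_nonneg.2 hs.le)
  have hnorm : 0 < ‖t‖ := norm_pos_iff.2 h0
  have h := P.norm_cauchy_le (mul_pos hs hnorm) fun k => mul_norm_le_norm_sub_ofReal ht _
  calc ‖P.cauchy t‖ * ‖t‖ ≤ (∑' k, ‖P.res k‖) * (s * ‖t‖)⁻¹ * ‖t‖ := by gcongr
    _ = (∑' k, ‖P.res k‖) * s⁻¹ := by field_simp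

end Sector

lemma hasSum_pole_taylor {a : ℝ} {t : ℂ} (ht : ‖t‖ < |a|) :
    HasSum (fun m : ℕ => -((a : ℂ) ^ (m + 1))⁻¹ * t ^ m) (t - a)⁻¹ := by
  have ha : (a : ℂ) ≠ 0 := ofReal_ne_zero.2 (abs_pos.1 ((norm_nonneg t).trans_lt ht))
  have hratio : ‖t / a‖ < 1 := by
    rwa [norm_div, norm_real, Real.norm_eq_abs, div_lt_one ((norm_nonneg t).trans_lt ht)]
  convert! (hasSum_geometric_of_norm_lt_one hratio).mul_left (-(a : ℂ)⁻¹) using 1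
  · ext m
    rw [pow_succ', mul_inv, div_pow]
    ring
  · rw [← neg_sub, one_sub_div ha, inv_div, inv_neg]
    field_simp

lemma summable_taylor {t : ℂ} (ht : ‖t‖ < P.gap) :
    Summable fun p : ι × ℕ => P.res p.1 * (-((P.pos p.1 : ℂ) ^ (p.2 + 1))⁻¹ * t ^ p.2) := by
  have hgap := P.gap_pos
  have hgeom : Summable fun m : ℕ => P.gap⁻¹ * (‖t‖ / P.gap) ^ m :=
    (summable_geometric_of_lt_one (by positivity) ((div_lt_one hgap).2 ht)).mul_left _
  refine .of_norm_bounded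
    (P.summable_norm_res.mul_of_nonneg hgeom (fun _ => norm_nonneg _) fun _ => by positivity)
    fun p => ?_
  have hpow : (|P.pos p.1| ^ (p.2 + 1))⁻¹ ≤ (P.gap ^ (p.2 + 1))⁻¹ := by
    gcongr; exact P.gap_le p.1
  calc _ = ‖P.res p.1‖ * ((|P.pos p.1| ^ (p.2 + 1))⁻¹ * ‖t‖ ^ p.2) := by simp
    _ ≤ ‖P.res p.1‖ * ((P.gap ^ (p.2 + 1))⁻¹ * ‖t‖ ^ p.2) := by gcongr
    _ = ‖P.res p.1‖ * (P.gap⁻¹ * (‖t‖ / P.gap) ^ p.2) := by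
      rw [pow_succ', mul_inv, div_pow]; ring

/-- The Taylor coefficients of `P.cauchy` at the origin. -/
def taylorCoeff (m : ℕ) : ℂ := ∑' k, -(P.res k * ((P.pos k : ℂ) ^ (m + 1))⁻¹)

lemma hasSum_taylorCoeff (m : ℕ) :
    HasSum (fun k => -(P.res k * ((P.pos k : ℂ) ^ (m + 1))⁻¹)) (P.taylorCoeff m) := by
  refine (Summable.of_norm_bounded (P.summable_norm_res.mul_right (P.gap ^ (m + 1))⁻¹)
    fun k => ?_).hasSum
  have := P.gap_pos
  rw [norm_neg, norm_mul, norm_inv, norm_pow, norm_real, Real.norm_eq_abs]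
  gcongr
  exact P.gap_le k

lemma hasSum_taylorCoeff_mul_pow {t : ℂ} (ht : ‖t‖ < P.gap) :
    HasSum (fun m => P.taylorCoeff m * t ^ m) (P.cauchy t) := by
  have hsum := P.summable_taylor ht
  have hrows : HasSum (fun k => P.res k * (t - P.pos k)⁻¹) _ := hsum.hasSum.prod_fiberwise
    fun k => (hasSum_pole_taylor (ht.trans_le (P.gap_le k))).mul_left (P.res k)
  have hcols := ((Equiv.prodComm ℕ ι).hasSum_iff.2 hsum.hasSum).prod_fiberwise
    fun m => (hsum.prod_symm.prod_factor m).hasSum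
  rw [cauchy, hrows.tsum_eq]
  refine hcols.congr_fun fun m => ?_
  rw [taylorCoeff, ← tsum_mul_right]
  exact tsum_congr fun k => by simp only [Prod.swap]; ring

lemma iteratedDeriv_cauchy_zero (m : ℕ) :
    iteratedDeriv m P.cauchy 0 = m.factorial * P.taylorCoeff m :=
  iteratedDeriv_zero_eq_of_hasSum P.gap_pos
    (fun _ ht => P.hasSum_taylorCoeff_mul_pow (mem_ball_zero_iff.1 ht)) m

lemma iteratedDeriv_add_three_primitive_zero (m : ℕ) :
    iteratedDeriv (m + 3) P.primitive 0 = iteratedDeriv m P.cauchy 0 := by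
  have h : iteratedDeriv 3 P.primitive =ᶠ[𝓝 0] P.cauchy :=
    P.iteratedDeriv_three_primitive.eventuallyEq_of_mem
      (P.isOpen_domain.mem_nhds P.zero_mem_domain)
  rw [← h.iteratedDeriv_eq m]
  simp only [iteratedDeriv_eq_iterate, Function.iterate_add_apply]

end RealPoles

/-! ### Rotation of rays of integration -/

/-- The point at distance `r` on the ray of angle `θ`. -/
def ray (θ r : ℝ) : ℂ := r * exp (θ * I)

/-- The closed sector between the rays of angles `θ₁` and `θ₂`. -/
def sector (θ₁ θ₂ : ℝ) : Set ℂ := Set.image2 ray (Set.Icc θ₁ θ₂) (Set.Ici 0)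

lemma continuous_ray : Continuous fun p : ℝ × ℝ => ray p.1 p.2 := by
  unfold ray; fun_prop

lemma exp_eq_ray (w : ℂ) : exp w = ray w.im (Real.exp w.re) := by
  rw [ray, ofReal_exp, ← exp_add, re_add_im]

lemma norm_ray (θ : ℝ) {r : ℝ} (hr : 0 ≤ r) : ‖ray θ r‖ = r := by
  rw [ray, norm_mul, norm_exp_ofReal_mul_I, mul_one, norm_real, Real.norm_of_nonneg hr]

lemma ray_zero (θ : ℝ) : ray θ 0 = 0 := by simp [ray]

lemma ray_angle_zero (r : ℝ) : ray 0 r = r := by simp [ray]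

lemma ray_re (θ r : ℝ) : (ray θ r).re = r * Real.cos θ := by
  rw [ray, re_ofReal_mul, exp_ofReal_mul_I_re]

lemma ray_im (θ r : ℝ) : (ray θ r).im = r * Real.sin θ := by
  rw [ray, im_ofReal_mul, exp_ofReal_mul_I_im]

lemma hasDerivAt_ray (θ r : ℝ) : HasDerivAt (ray θ) (exp (θ * I)) r := by
  have h := (hasDerivAt_id r).ofReal_comp.mul_const (exp (θ * I))
  rwa [ofReal_one, one_mul] at h

section Rotation

variable {h : ℂ → ℂ} {θ θ₁ θ₂ ε X : ℝ}

lemma continuousOn_comp_ray (hc : ContinuousOn h (sector θ₁ θ₂)) (hθ : θ ∈ Set.Icc θ₁ θ₂) :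
    ContinuousOn (fun r => h (ray θ r)) (Set.Ici 0) :=
  hc.comp (continuous_ray.comp (.prodMk_right θ)).continuousOn
    fun _ hr => Set.mem_image2_of_mem hθ hr

lemma integral_ray_eq_integral_exp (hε : 0 < ε) (hX : 0 < X)
    (hc : ContinuousOn (fun r => h (ray θ r)) (Set.Ici 0)) :
    ∫ r in ε..X, h (ray θ r) * exp (θ * I) =
      ∫ x in Real.log ε..Real.log X, h (exp (x + θ * I)) * exp (x + θ * I) := by
  have hsub := intervalIntegral.integral_deriv_smul_comp'' (a := Real.log ε) (b := Real.log X)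
    (f := Real.exp) (f' := Real.exp) (g := fun r : ℝ => h (ray θ r) * exp (θ * I))
    Real.continuous_exp.continuousOn
    (fun x _ => (Real.hasDerivAt_exp x).hasDerivWithinAt) Real.continuous_exp.continuousOn
    ((hc.mul continuousOn_const).mono (by rintro _ ⟨x, -, rfl⟩; exact (Real.exp_pos x).le))
  rw [Real.exp_log hε, Real.exp_log hX] at hsub
  rw [← hsub]
  refine intervalIntegral.integral_congr fun x _ => ?_
  have hray : exp (x + θ * I) = ray θ (Real.exp x) := by simp [exp_eq_ray]
  simp only [Function.comp_apply, real_smul, hray]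
  rw [ray]
  ring

/-- Cauchy's theorem for an annular sector, which `exp` straightens into a rectangle. -/
lemma integral_ray_sub_annulus (hθ : θ₁ ≤ θ₂) (hε : 0 < ε) (hX : ε ≤ X)
    (hc : ContinuousOn h (sector θ₁ θ₂))
    (hd : ∀ θ ∈ Set.Ioo θ₁ θ₂, ∀ r, 0 < r → DifferentiableAt ℂ h (ray θ r)) :
    (∫ r in ε..X, h (ray θ₁ r) * exp (θ₁ * I)) - (∫ r in ε..X, h (ray θ₂ r) * exp (θ₂ * I)) +
      I * (∫ θ in θ₁..θ₂, h (ray θ X) * ray θ X) -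
      I * (∫ θ in θ₁..θ₂, h (ray θ ε) * ray θ ε) = 0 := by
  have hX0 : 0 < X := hε.trans_le hX
  have hbox := integral_boundary_rect_eq_zero_of_continuousOn_of_differentiableOn
    (fun w => h (exp w) * exp w) (Real.log ε + θ₁ * I) (Real.log X + θ₂ * I)
    (by
      refine (hc.comp continuous_exp.continuousOn fun w hw => ?_).mul continuous_exp.continuousOn
      have him := hw.2
      simp only [add_im, ofReal_im, mul_im, ofReal_re, I_im, I_re, mul_one, mul_zero, add_zero,
        zero_add, Set.mem_preimage, Set.uIcc_of_le hθ] at him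
      exact exp_eq_ray w ▸ Set.mem_image2_of_mem him (Real.exp_pos _).le)
    (by
      intro w hw
      have him := hw.2
      simp only [add_im, ofReal_im, mul_im, ofReal_re, I_im, I_re, mul_one, mul_zero, add_zero,
        zero_add, Set.mem_preimage, min_eq_left hθ, max_eq_right hθ] at him
      have hw' := hd w.im him _ (Real.exp_pos w.re)
      rw [← exp_eq_ray] at hw'
      exact ((hw'.comp w differentiableAt_exp).mul differentiableAt_exp).differentiableWithinAt)
  have hexp : ∀ θ r : ℝ, 0 < r → exp (Real.log r + θ * I) = ray θ r := fun θ r hr => by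
    simp [exp_eq_ray, Real.exp_log hr]
  simp only [add_re, ofReal_re, mul_re, I_re, mul_zero, ofReal_im, I_im, mul_one, sub_self,
    add_zero, add_im, mul_im, zero_add, smul_eq_mul, hexp _ _ hε, hexp _ _ hX0] at hbox
  rwa [integral_ray_eq_integral_exp hε hX0 (continuousOn_comp_ray hc ⟨le_rfl, hθ⟩),
    integral_ray_eq_integral_exp hε hX0 (continuousOn_comp_ray hc ⟨hθ, le_rfl⟩)]

lemma tendsto_small_arc (hθ : θ₁ ≤ θ₂) (hc : ContinuousOn h (sector θ₁ θ₂)) :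
    Tendsto (fun ε : ℝ => ∫ θ in θ₁..θ₂, h (ray θ ε) * ray θ ε) (𝓝[>] 0) (𝓝 0) := by
  obtain ⟨M, hM⟩ := (isCompact_Icc.prod isCompact_Icc).exists_bound_of_continuousOn
    (s := Set.Icc θ₁ θ₂ ×ˢ Set.Icc (0 : ℝ) 1) (f := fun q : ℝ × ℝ => h (ray q.1 q.2))
    (hc.comp continuous_ray.continuousOn fun q hq => Set.mem_image2_of_mem hq.1 hq.2.1)
  have hlim : Tendsto (fun ε : ℝ => M * ε * |θ₂ - θ₁|) (𝓝[>] 0) (𝓝 0) :=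
    ((by fun_prop : Continuous fun ε : ℝ => M * ε * |θ₂ - θ₁|).tendsto' 0 0
      (by simp)).mono_left nhdsWithin_le_nhds
  refine squeeze_zero_norm' ?_ hlim
  filter_upwards [Ioc_mem_nhdsGT (zero_lt_one' ℝ)] with ε hε
  refine intervalIntegral.norm_integral_le_of_norm_le_const fun θ hmem => ?_
  rw [Set.uIoc_of_le hθ] at hmem
  rw [norm_mul, norm_ray θ hε.1.le]
  exact mul_le_mul_of_nonneg_right (hM (θ, ε) ⟨⟨hmem.1.le, hmem.2⟩, hε.1.le, hε.2⟩) hε.1.le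

lemma integral_ray_sub (hθ : θ₁ ≤ θ₂) (hX : 0 < X) (hc : ContinuousOn h (sector θ₁ θ₂))
    (hd : ∀ θ ∈ Set.Ioo θ₁ θ₂, ∀ r, 0 < r → DifferentiableAt ℂ h (ray θ r)) :
    (∫ r in 0..X, h (ray θ₁ r) * exp (θ₁ * I)) - (∫ r in 0..X, h (ray θ₂ r) * exp (θ₂ * I)) +
      I * (∫ θ in θ₁..θ₂, h (ray θ X) * ray θ X) = 0 := by
  have hray : ∀ θ ∈ Set.Icc θ₁ θ₂, Tendsto (fun ε : ℝ => ∫ r in ε..X, h (ray θ r) * exp (θ * I))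
      (𝓝[>] 0) (𝓝 (∫ r in 0..X, h (ray θ r) * exp (θ * I))) := fun θ hmem => by
    have hcont : ContinuousOn (fun r : ℝ => h (ray θ r) * exp (θ * I)) (Set.uIcc 0 X) :=
      ((continuousOn_comp_ray hc hmem).mul continuousOn_const).mono
        (by rw [Set.uIcc_of_le hX.le]; exact Set.Icc_subset_Ici_self)
    refine (intervalIntegral.continuousOn_primitive_interval_left (μ := volume)
      (hcont.integrableOn_compact isCompact_uIcc) 0 Set.left_mem_uIcc).mono_left ?_
    rw [Set.uIcc_of_le hX.le]
    exact nhdsWithin_le_iff.2 (mem_of_superset (Ioc_mem_nhdsGT hX) Set.Ioc_subset_Icc_self)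
  have hlim := (((hray θ₁ ⟨le_rfl, hθ⟩).sub (hray θ₂ ⟨hθ, le_rfl⟩)).add
    (tendsto_const_nhds (x := I * (∫ θ in θ₁..θ₂, h (ray θ X) * ray θ X)))).sub
      ((tendsto_small_arc hθ hc).const_mul I)
  rw [mul_zero, sub_zero] at hlim
  refine tendsto_nhds_unique hlim (tendsto_const_nhds.congr' ?_)
  filter_upwards [Ioc_mem_nhdsGT hX] with ε hε
  exact (integral_ray_sub_annulus hθ hε.1 hε.2 hc hd).symm

lemma tendsto_large_arc {K : ℝ} (hθ : θ₁ ≤ θ₂) (hc : ContinuousOn h (sector θ₁ θ₂))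
    (hK : ∀ᶠ r in atTop, ∀ θ ∈ Set.Icc θ₁ θ₂, ‖h (ray θ r)‖ * r ≤ K)
    (hzero : ∀ θ ∈ Set.Ioo θ₁ θ₂, Tendsto (fun r => ‖h (ray θ r)‖ * r) atTop (𝓝 0)) :
    Tendsto (fun X : ℝ => ∫ θ in θ₁..θ₂, h (ray θ X) * ray θ X) atTop (𝓝 0) := by
  rw [← intervalIntegral.integral_zero (a := θ₁) (b := θ₂)]
  refine intervalIntegral.tendsto_integral_filter_of_dominated_convergence (fun _ => K) ?_ ?_
    intervalIntegrable_const ?_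
  · filter_upwards [eventually_ge_atTop 0] with X hX
    rw [Set.uIoc_of_le hθ]
    refine ContinuousOn.aestronglyMeasurable ?_ measurableSet_Ioc
    have hray : Continuous fun θ => ray θ X := continuous_ray.comp (.prodMk_left X)
    exact (hc.comp hray.continuousOn fun θ hmem =>
      Set.mem_image2_of_mem (Set.Ioc_subset_Icc_self hmem) hX).mul hray.continuousOn
  · filter_upwards [eventually_ge_atTop 0, hK] with X hX hKX
    refine Eventually.of_forall fun θ hmem => ?_
    rw [Set.uIoc_of_le hθ] at hmem
    rw [norm_mul, norm_ray θ hX]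
    exact hKX θ (Set.Ioc_subset_Icc_self hmem)
  · filter_upwards [compl_mem_ae_iff.2 (measure_singleton θ₂)] with θ hne hmem
    rw [Set.uIoc_of_le hθ] at hmem
    rw [tendsto_zero_iff_norm_tendsto_zero]
    refine (hzero θ ⟨hmem.1, lt_of_le_of_ne hmem.2 hne⟩).congr' ?_
    filter_upwards [eventually_ge_atTop 0] with X hX
    rw [norm_mul, norm_ray θ hX]

theorem tendsto_integral_ray_sub {K : ℝ} (hθ : θ₁ ≤ θ₂) (hc : ContinuousOn h (sector θ₁ θ₂))
    (hd : ∀ θ ∈ Set.Ioo θ₁ θ₂, ∀ r, 0 < r → DifferentiableAt ℂ h (ray θ r))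
    (hK : ∀ᶠ r in atTop, ∀ θ ∈ Set.Icc θ₁ θ₂, ‖h (ray θ r)‖ * r ≤ K)
    (hzero : ∀ θ ∈ Set.Ioo θ₁ θ₂, Tendsto (fun r => ‖h (ray θ r)‖ * r) atTop (𝓝 0)) :
    Tendsto (fun X : ℝ => (∫ r in 0..X, h (ray θ₁ r) * exp (θ₁ * I)) -
      ∫ r in 0..X, h (ray θ₂ r) * exp (θ₂ * I)) atTop (𝓝 0) := by
  have harc := ((tendsto_large_arc hθ hc hK hzero).const_mul I).neg
  rw [mul_zero, neg_zero] at harc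
  refine harc.congr' ?_
  filter_upwards [eventually_gt_atTop 0] with X hX
  linear_combination -integral_ray_sub hθ hX hc hd

end Rotation

/-! ### Laplace integrals along rays -/

lemma integrableOn_pow_mul_exp_neg (n : ℕ) {c : ℝ} (hc : 0 < c) :
    IntegrableOn (fun x : ℝ => x ^ n * Real.exp (-(c * x))) (Set.Ioi 0) := by
  have hn : (-1 : ℝ) < n := neg_one_lt_zero.trans_le n.cast_nonneg
  simpa using integrableOn_rpow_mul_exp_neg_mul_rpow hn one_pos hc

lemma tendsto_pow_mul_exp_neg (n : ℕ) {c : ℝ} (hc : 0 < c) :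
    Tendsto (fun x : ℝ => x ^ n * Real.exp (-(c * x))) atTop (𝓝 0) := by
  simpa using tendsto_rpow_mul_exp_neg_mul_atTop_nhds_zero n c hc

section HalfLine

variable {g g' : ℝ → ℂ} {κ : ℂ} {K : ℝ} {n : ℕ}

lemma integrableOn_mul_exp_neg (hg : ContinuousOn g (Set.Ici 0))
    (hK : ∀ r, 0 ≤ r → ‖g r‖ ≤ K * r ^ n) (hκ : 0 < κ.re) :
    IntegrableOn (fun r : ℝ => g r * exp (-(r * κ))) (Set.Ioi 0) := by
  refine ((integrableOn_pow_mul_exp_neg n hκ).const_mul K).mono'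
    (((hg.mono Set.Ioi_subset_Ici_self).mul (by fun_prop)).aestronglyMeasurable
      measurableSet_Ioi) ?_
  filter_upwards [ae_restrict_mem measurableSet_Ioi] with r hr
  rw [norm_mul, norm_exp, neg_re, re_ofReal_mul, mul_comm r κ.re, ← mul_assoc]
  exact mul_le_mul_of_nonneg_right (hK r (Set.mem_Ioi.1 hr).le) (Real.exp_pos _).le

lemma norm_le_mul_pow_succ (h0 : g 0 = 0) (hd : ∀ r, 0 ≤ r → HasDerivAt g (g' r) r)
    (hK : ∀ r, 0 ≤ r → ‖g' r‖ ≤ K * r ^ n) {r : ℝ} (hr : 0 ≤ r) : ‖g r‖ ≤ K * r ^ (n + 1) := by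
  have hK0 : 0 ≤ K := by simpa using (norm_nonneg _).trans (hK 1 zero_le_one)
  have h := norm_image_sub_le_of_norm_deriv_le_segment' (a := 0) (b := r) (C := K * r ^ n)
    (fun x hx => (hd x hx.1).hasDerivWithinAt)
    (fun x hx => (hK x hx.1).trans (by have := hx.1; have := hx.2.le; gcongr)) r ⟨hr, le_rfl⟩
  rwa [h0, sub_zero, sub_zero, mul_assoc, ← pow_succ] at h

lemma integral_deriv_mul_exp_neg (h0 : g 0 = 0) (hd : ∀ r, 0 ≤ r → HasDerivAt g (g' r) r)
    (hg' : ContinuousOn g' (Set.Ici 0)) (hK : ∀ r, 0 ≤ r → ‖g' r‖ ≤ K * r ^ n) (hκ : 0 < κ.re) :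
    ∫ r in Set.Ioi (0 : ℝ), g' r * exp (-(r * κ)) =
      κ * ∫ r in Set.Ioi (0 : ℝ), g r * exp (-(r * κ)) := by
  have hcont : ContinuousOn g (Set.Ici 0) := fun r hr =>
    (hd r hr).continuousAt.continuousWithinAt
  have hi := integrableOn_mul_exp_neg hcont (fun _ => norm_le_mul_pow_succ h0 hd hK) hκ
  have hi' := integrableOn_mul_exp_neg hg' hK hκ
  have hprod : ∀ r ∈ Set.Ici (0 : ℝ), HasDerivAt (fun r : ℝ => g r * exp (-(r * κ)))
      (g' r * exp (-(r * κ)) - κ * (g r * exp (-(r * κ)))) r := fun r hr => by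
    have hexp := ((hasDerivAt_id r).ofReal_comp.mul_const κ).neg.cexp
    refine ((hd r hr).mul hexp).congr_deriv ?_
    simp only [Pi.neg_apply, id, ofReal_one]
    ring
  have hint := hi'.sub (hi.const_mul κ)
  have hlim := tendsto_zero_of_hasDerivAt_of_integrableOn_Ioi
    (fun r hr => hprod r (Set.mem_Ici_of_Ioi hr)) hint hi
  have h := integral_Ioi_of_hasDerivAt_of_tendsto' hprod hint hlim
  rw [integral_sub hi' (hi.const_mul κ), integral_const_mul, h0, zero_mul, sub_zero] at h
  exact sub_eq_zero.1 h

end HalfLine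

/-- The integrand of the Laplace integral `∫ h(t) e^{-t/β} dt` along the ray of angle `θ`. -/
def laplaceRay (h : ℂ → ℂ) (β : ℂ) (θ r : ℝ) : ℂ :=
  h (ray θ r) * exp (-ray θ r / β) * exp (θ * I)

lemma ray_div (θ r : ℝ) (β : ℂ) : ray θ r / β = ray (θ - β.arg) (r / ‖β‖) := by
  conv_lhs => rw [← norm_mul_exp_arg_mul_I β]
  rw [ray, ray, mul_div_mul_comm, ← exp_sub, ofReal_div, ofReal_sub, sub_mul]

lemma norm_exp_neg_ray_div (θ r : ℝ) (β : ℂ) :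
    ‖exp (-ray θ r / β)‖ = Real.exp (-(Real.cos (θ - β.arg) / ‖β‖ * r)) := by
  rw [norm_exp, neg_div, neg_re, ray_div, ray_re]
  ring_nf

section LaplaceRay

variable {h h' : ℂ → ℂ} {β : ℂ} {θ θ₁ θ₂ K m : ℝ} {n : ℕ}

lemma laplaceRay_eq (h : ℂ → ℂ) (β : ℂ) (θ r : ℝ) :
    laplaceRay h β θ r = h (ray θ r) * exp (θ * I) * exp (-(r * (exp (θ * I) / β))) := by
  rw [laplaceRay, ray, mul_right_comm, neg_div, mul_div_assoc]

lemma re_exp_mul_I_div_pos (hβ : β ≠ 0) (hcos : 0 < Real.cos (θ - β.arg)) :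
    0 < (exp (θ * I) / β).re := by
  have hray : exp (θ * I) = ray θ 1 := by rw [ray, ofReal_one, one_mul]
  rw [hray, ray_div, ray_re]
  have := norm_pos_iff.2 hβ
  positivity

lemma norm_mul_exp_mul_I_le (hK : ∀ r, 0 ≤ r → ‖h (ray θ r)‖ ≤ K * r ^ n) (r : ℝ) (hr : 0 ≤ r) :
    ‖h (ray θ r) * exp (θ * I)‖ ≤ K * r ^ n := by
  rw [norm_mul, norm_exp_ofReal_mul_I, mul_one]
  exact hK r hr

lemma integrableOn_laplaceRay (hβ : β ≠ 0) (hcos : 0 < Real.cos (θ - β.arg))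
    (hc : ContinuousOn (fun r => h (ray θ r)) (Set.Ici 0))
    (hK : ∀ r, 0 ≤ r → ‖h (ray θ r)‖ ≤ K * r ^ n) :
    IntegrableOn (laplaceRay h β θ) (Set.Ioi 0) := by
  simp only [funext (laplaceRay_eq h β θ)]
  exact integrableOn_mul_exp_neg (hc.mul continuousOn_const) (norm_mul_exp_mul_I_le hK)
    (re_exp_mul_I_div_pos hβ hcos)

lemma integral_laplaceRay_deriv (hβ : β ≠ 0) (hcos : 0 < Real.cos (θ - β.arg)) (h0 : h 0 = 0)
    (hd : ∀ r, 0 ≤ r → HasDerivAt h (h' (ray θ r)) (ray θ r))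
    (hc : ContinuousOn (fun r => h' (ray θ r)) (Set.Ici 0))
    (hK : ∀ r, 0 ≤ r → ‖h' (ray θ r)‖ ≤ K * r ^ n) :
    ∫ r in Set.Ioi (0 : ℝ), laplaceRay h' β θ r =
      β⁻¹ * ∫ r in Set.Ioi (0 : ℝ), laplaceRay h β θ r := by
  have hparts := integral_deriv_mul_exp_neg (g := fun r => h (ray θ r)) (by rw [ray_zero, h0])
    (fun r hr => (hd r hr).comp r (hasDerivAt_ray θ r)) (hc.mul continuousOn_const)
    (norm_mul_exp_mul_I_le hK) (re_exp_mul_I_div_pos hβ hcos)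
  simp only [laplaceRay_eq, hparts, ← integral_const_mul]
  exact integral_congr_ae (.of_forall fun r => by ring)

lemma norm_le_mul_pow_succ_ray (h0 : h 0 = 0)
    (hd : ∀ r, 0 ≤ r → HasDerivAt h (h' (ray θ r)) (ray θ r))
    (hK : ∀ r, 0 ≤ r → ‖h' (ray θ r)‖ ≤ K * r ^ n) (r : ℝ) (hr : 0 ≤ r) :
    ‖h (ray θ r)‖ ≤ K * r ^ (n + 1) :=
  norm_le_mul_pow_succ (g := fun r => h (ray θ r)) (by rw [ray_zero, h0])
    (fun r hr => (hd r hr).comp r (hasDerivAt_ray θ r)) (norm_mul_exp_mul_I_le hK) hr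

lemma tendsto_integral_laplaceRay_sub (hθ : θ₁ ≤ θ₂) (hc : ContinuousOn h (sector θ₁ θ₂))
    (hd : ∀ θ ∈ Set.Ioo θ₁ θ₂, ∀ r, 0 < r → DifferentiableAt ℂ h (ray θ r))
    (hK : ∀ᶠ r in atTop, ∀ θ ∈ Set.Icc θ₁ θ₂,
      ‖h (ray θ r)‖ * r * Real.exp (-(Real.cos (θ - β.arg) / ‖β‖ * r)) ≤ K)
    (hzero : ∀ θ ∈ Set.Ioo θ₁ θ₂, Tendsto (fun r =>
      ‖h (ray θ r)‖ * r * Real.exp (-(Real.cos (θ - β.arg) / ‖β‖ * r))) atTop (𝓝 0)) :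
    Tendsto (fun X : ℝ => (∫ r in 0..X, laplaceRay h β θ₁ r) - ∫ r in 0..X, laplaceRay h β θ₂ r)
      atTop (𝓝 0) := by
  have hnorm : ∀ θ r : ℝ, ‖h (ray θ r) * exp (-ray θ r / β)‖ * r =
      ‖h (ray θ r)‖ * r * Real.exp (-(Real.cos (θ - β.arg) / ‖β‖ * r)) := fun θ r => by
    rw [norm_mul, norm_exp_neg_ray_div, mul_right_comm]
  exact tendsto_integral_ray_sub (h := fun t => h t * exp (-t / β)) (K := K) hθ
    (hc.mul (by fun_prop)) (fun θ hmem r hr => (hd θ hmem r hr).mul (by fun_prop))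
    (by simpa only [hnorm] using hK) (by simpa only [hnorm] using hzero)

lemma integral_laplaceRay_eq (hβ : β ≠ 0) (hθ : θ₁ ≤ θ₂) (hc : ContinuousOn h (sector θ₁ θ₂))
    (hd : ∀ θ ∈ Set.Ioo θ₁ θ₂, ∀ r, 0 < r → DifferentiableAt ℂ h (ray θ r))
    (hK : ∀ t, ‖h t‖ ≤ K * ‖t‖ ^ n) (hm : 0 < m)
    (hcos : ∀ θ ∈ Set.Icc θ₁ θ₂, m ≤ Real.cos (θ - β.arg)) :
    ∫ r in Set.Ioi (0 : ℝ), laplaceRay h β θ₁ r = ∫ r in Set.Ioi (0 : ℝ), laplaceRay h β θ₂ r := by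
  have hb : 0 < ‖β‖ := norm_pos_iff.2 hβ
  have hgrowth : ∀ θ r : ℝ, 0 ≤ r → ‖h (ray θ r)‖ ≤ K * r ^ n := fun θ r hr => by
    simpa only [norm_ray θ hr] using hK (ray θ r)
  have hdecay : ∀ r, 0 ≤ r → ∀ θ ∈ Set.Icc θ₁ θ₂,
      ‖h (ray θ r)‖ * r * Real.exp (-(Real.cos (θ - β.arg) / ‖β‖ * r)) ≤
        K * (r ^ (n + 1) * Real.exp (-(m / ‖β‖ * r))) := fun r hr θ hmem => by
    rw [pow_succ, ← mul_assoc, ← mul_assoc]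
    have hK0 := (norm_nonneg _).trans (hgrowth θ r hr)
    gcongr
    exacts [hgrowth θ r hr, hcos θ hmem]
  have hlim : Tendsto (fun r : ℝ => K * (r ^ (n + 1) * Real.exp (-(m / ‖β‖ * r)))) atTop
      (𝓝 0) := by
    simpa using (tendsto_pow_mul_exp_neg (n + 1) (div_pos hm hb)).const_mul K
  have hdiff := tendsto_integral_laplaceRay_sub (K := 1) hθ hc hd
    (by
      filter_upwards [eventually_ge_atTop 0, hlim.eventually_le_const one_pos] with r hr hr1 θ hmem
      exact (hdecay r hr θ hmem).trans hr1)
    fun θ hmem => squeeze_zero'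
      (by filter_upwards [eventually_ge_atTop 0] with r hr using by positivity)
      (by filter_upwards [eventually_ge_atTop 0] with r hr using
        hdecay r hr θ (Set.Ioo_subset_Icc_self hmem)) hlim
  have hconv : ∀ θ ∈ Set.Icc θ₁ θ₂, Tendsto (fun X => ∫ r in 0..X, laplaceRay h β θ r) atTop
      (𝓝 (∫ r in Set.Ioi (0 : ℝ), laplaceRay h β θ r)) := fun θ hmem =>
    intervalIntegral_tendsto_integral_Ioi 0 (integrableOn_laplaceRay hβ
      (hm.trans_le (hcos θ hmem)) (continuousOn_comp_ray hc hmem) (hgrowth θ)) tendsto_id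
  exact sub_eq_zero.1 (tendsto_nhds_unique
    ((hconv θ₁ ⟨le_rfl, hθ⟩).sub (hconv θ₂ ⟨hθ, le_rfl⟩)) hdiff)

lemma tendsto_integral_laplaceRay_sub_of_abs_sub_arg_le (hβ : β ≠ 0) (hθ : θ₁ ≤ θ₂)
    (hc : ContinuousOn h (sector θ₁ θ₂))
    (hd : ∀ θ ∈ Set.Ioo θ₁ θ₂, ∀ r, 0 < r → DifferentiableAt ℂ h (ray θ r))
    (hK : ∀ t ∈ sector θ₁ θ₂, ‖h t‖ * ‖t‖ ≤ K)
    (h₁ : |θ₁ - β.arg| ≤ Real.pi / 2) (h₂ : |θ₂ - β.arg| ≤ Real.pi / 2) :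
    Tendsto (fun X : ℝ => (∫ r in 0..X, laplaceRay h β θ₁ r) - ∫ r in 0..X, laplaceRay h β θ₂ r)
      atTop (𝓝 0) := by
  rw [abs_le] at h₁ h₂
  have hgrowth : ∀ r, 0 ≤ r → ∀ θ ∈ Set.Icc θ₁ θ₂, ‖h (ray θ r)‖ * r ≤ K := fun r hr θ hmem => by
    simpa only [norm_ray θ hr] using hK (ray θ r) (Set.mem_image2_of_mem hmem hr)
  refine tendsto_integral_laplaceRay_sub (K := K) hθ hc hd ?_ fun θ hmem => ?_
  · filter_upwards [eventually_ge_atTop 0] with r hr θ hmem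
    have hcos : 0 ≤ Real.cos (θ - β.arg) :=
      Real.cos_nonneg_of_mem_Icc ⟨by linarith [hmem.1], by linarith [hmem.2]⟩
    exact (mul_le_of_le_one_right (by positivity)
      (Real.exp_le_one_iff.2 (neg_nonpos.2 (by positivity)))).trans (hgrowth r hr θ hmem)
  · have hcos : 0 < Real.cos (θ - β.arg) :=
      Real.cos_pos_of_mem_Ioo ⟨by linarith [hmem.1], by linarith [hmem.2]⟩
    have hlim := (tendsto_pow_mul_exp_neg 0 (div_pos hcos (norm_pos_iff.2 hβ))).const_mul K
    simp only [pow_zero, one_mul, mul_zero] at hlim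
    refine squeeze_zero' ?_ ?_ hlim
    · filter_upwards [eventually_ge_atTop 0] with r hr using by positivity
    · filter_upwards [eventually_ge_atTop 0] with r hr using
        mul_le_mul_of_nonneg_right (hgrowth r hr θ (Set.Ioo_subset_Icc_self hmem))
          (Real.exp_pos _).le

end LaplaceRay

lemma exists_pos_le_of_continuous {f : ℝ → ℝ} {a b : ℝ} (hf : Continuous f)
    (hpos : ∀ x ∈ Set.Icc a b, 0 < f x) : ∃ m, 0 < m ∧ ∀ x ∈ Set.Icc a b, m ≤ f x := by
  rcases (Set.Icc a b).eq_empty_or_nonempty with he | hne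
  · exact ⟨1, one_pos, by simp [he]⟩
  obtain ⟨x, hx, hmin⟩ := isCompact_Icc.exists_isMinOn hne hf.continuousOn
  exact ⟨f x, hpos x hx, hmin⟩

lemma ray_mem_closedQuadrant {θ r : ℝ} (hθ : θ ∈ Set.Icc 0 (Real.pi / 2)) (hr : 0 ≤ r) :
    ray θ r ∈ closedQuadrant := by
  have hcos := Real.cos_nonneg_of_mem_Icc (x := θ) ⟨by linarith [Real.pi_pos, hθ.1], hθ.2⟩
  have hsin := Real.sin_nonneg_of_mem_Icc (x := θ) ⟨hθ.1, by linarith [Real.pi_pos, hθ.2]⟩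
  exact ⟨by rw [ray_re]; positivity, by rw [ray_im]; positivity⟩

namespace RealPoles

variable {ι : Type*} (P : RealPoles ι) {β : ℂ} {θ θ₁ θ₂ : ℝ}

lemma ray_mem_domain (hθ : θ ∈ Set.Ioo 0 Real.pi) {r : ℝ} (hr : 0 ≤ r) : ray θ r ∈ P.domain := by
  rcases hr.eq_or_lt with rfl | hr
  · rw [ray_zero]
    exact P.zero_mem_domain
  · exact Or.inr (by rw [Set.mem_ofPred_eq, ray_im]; exact mul_pos hr (Real.sin_pos_of_mem_Ioo hθ))

lemma exists_norm_cauchy_le_of_mem_sector (h₁ : 0 < θ₁) (h₂ : θ₂ < Real.pi) :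
    ∃ K, ∀ t ∈ sector θ₁ θ₂, ‖P.cauchy t‖ ≤ K ∧ ‖P.cauchy t‖ * ‖t‖ ≤ K := by
  obtain ⟨s, hs, hsin⟩ := exists_pos_le_of_continuous (a := θ₁) (b := θ₂) Real.continuous_sin
    fun θ hθ => Real.sin_pos_of_mem_Ioo ⟨h₁.trans_le hθ.1, hθ.2.trans_lt h₂⟩
  refine ⟨max ((∑' k, ‖P.res k‖) * (s * P.gap)⁻¹) ((∑' k, ‖P.res k‖) * s⁻¹), ?_⟩
  rintro _ ⟨θ, hθ, r, hr, rfl⟩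
  have him : s * ‖ray θ r‖ ≤ (ray θ r).im := by
    rw [norm_ray θ hr, ray_im, mul_comm]
    exact mul_le_mul_of_nonneg_left (hsin θ hθ) hr
  exact ⟨(P.norm_cauchy_le_of_mul_norm_le_im hs ((hsin θ hθ).trans (Real.sin_le_one θ))
      him).trans (le_max_left _ _), (P.norm_cauchy_mul_norm_le hs him).trans (le_max_right _ _)⟩

lemma sector_subset_domain (h₁ : 0 < θ₁) (h₂ : θ₂ < Real.pi) : sector θ₁ θ₂ ⊆ P.domain := by
  rintro _ ⟨θ, hθ, r, hr, rfl⟩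
  exact P.ray_mem_domain ⟨h₁.trans_le hθ.1, hθ.2.trans_lt h₂⟩ hr

lemma continuousOn_cauchy_ray (hθ : θ ∈ Set.Ioo 0 Real.pi) :
    ContinuousOn (fun r => P.cauchy (ray θ r)) (Set.Ici 0) :=
  continuousOn_comp_ray (P.differentiableOn_cauchy.continuousOn.mono
    (P.sector_subset_domain hθ.1 hθ.2)) ⟨le_rfl, le_rfl⟩

lemma exists_norm_cauchy_ray_le (hθ : θ ∈ Set.Ioo 0 Real.pi) :
    ∃ K, ∀ r, 0 ≤ r → ‖P.cauchy (ray θ r)‖ ≤ K * r ^ 0 := by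
  obtain ⟨K, hK⟩ := P.exists_norm_cauchy_le_of_mem_sector hθ.1 hθ.2
  refine ⟨K, fun r hr => ?_⟩
  rw [pow_zero, mul_one]
  exact (hK _ (Set.mem_image2_of_mem (Set.left_mem_Icc.2 le_rfl) hr)).1

lemma integrableOn_laplaceRay_cauchy (hβ : β ≠ 0) (hθ : θ ∈ Set.Ioo 0 Real.pi)
    (hcos : 0 < Real.cos (θ - β.arg)) : IntegrableOn (laplaceRay P.cauchy β θ) (Set.Ioi 0) :=
  (P.exists_norm_cauchy_ray_le hθ).elim fun _ hK =>
    integrableOn_laplaceRay hβ hcos (P.continuousOn_cauchy_ray hθ) hK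

lemma integral_laplaceRay_cauchy (hβ : β ≠ 0) (hθ : θ ∈ Set.Ioo 0 Real.pi)
    (hcos : 0 < Real.cos (θ - β.arg)) :
    ∫ r in Set.Ioi (0 : ℝ), laplaceRay P.cauchy β θ r =
      (β ^ 3)⁻¹ * ∫ r in Set.Ioi (0 : ℝ), laplaceRay P.primitive β θ r := by
  set u : ℕ → ℂ → ℂ := fun j => iteratedDeriv j P.primitive with hu
  have hd : ∀ j, ∀ r, 0 ≤ r → HasDerivAt (u j) (u (j + 1) (ray θ r)) (ray θ r) := fun j r hr =>
    hasDerivAt_iteratedDeriv P.differentiableOn_primitive P.isOpen_domain j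
      (P.ray_mem_domain hθ hr)
  have hc : ∀ j, ContinuousOn (fun r => u j (ray θ r)) (Set.Ici 0) := fun j r hr =>
    ((hd j r hr).continuousAt.comp (hasDerivAt_ray θ r).continuousAt).continuousWithinAt
  have h0 : ∀ j < 3, u j 0 = 0 := fun j hj => P.iteratedDeriv_primitive_zero hj
  have hcauchy : ∀ r, 0 ≤ r → P.cauchy (ray θ r) = u 3 (ray θ r) := fun r hr =>
    (P.iteratedDeriv_three_primitive (P.ray_mem_domain hθ hr)).symm
  obtain ⟨K, hK₃⟩ := P.exists_norm_cauchy_ray_le hθ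
  replace hK₃ : ∀ r, 0 ≤ r → ‖u 3 (ray θ r)‖ ≤ K * r ^ 0 := fun r hr =>
    hcauchy r hr ▸ hK₃ r hr
  have hK₂ := norm_le_mul_pow_succ_ray (h0 2 (by norm_num)) (hd 2) hK₃
  have hK₁ := norm_le_mul_pow_succ_ray (h0 1 (by norm_num)) (hd 1) hK₂
  calc ∫ r in Set.Ioi (0 : ℝ), laplaceRay P.cauchy β θ r
      = ∫ r in Set.Ioi (0 : ℝ), laplaceRay (u 3) β θ r :=
        setIntegral_congr_fun measurableSet_Ioi fun r hr => by
          simp only [laplaceRay, hcauchy r (Set.mem_Ioi.1 hr).le]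
    _ = β⁻¹ * ∫ r in Set.Ioi (0 : ℝ), laplaceRay (u 2) β θ r :=
        integral_laplaceRay_deriv hβ hcos (h0 2 (by norm_num)) (hd 2) (hc 3) hK₃
    _ = β⁻¹ * (β⁻¹ * ∫ r in Set.Ioi (0 : ℝ), laplaceRay (u 1) β θ r) := by
        rw [integral_laplaceRay_deriv hβ hcos (h0 1 (by norm_num)) (hd 1) (hc 2) hK₂]
    _ = β⁻¹ * (β⁻¹ * (β⁻¹ * ∫ r in Set.Ioi (0 : ℝ), laplaceRay (u 0) β θ r)) := by
        rw [integral_laplaceRay_deriv hβ hcos (h0 0 (by norm_num)) (hd 0) (hc 1) hK₁]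
    _ = (β ^ 3)⁻¹ * ∫ r in Set.Ioi (0 : ℝ), laplaceRay P.primitive β θ r := by
        simp only [hu, iteratedDeriv_zero]
        ring

/-- The Laplace-Borel integral of `P.primitive`; unlike that of `P.cauchy`, it converges absolutely
on the real half-line. -/
def borelSum (β : ℂ) : ℂ := β⁻¹ * ∫ t in Set.Ioi (0 : ℝ), P.primitive t * exp (-(t : ℂ) / β)

lemma integral_laplaceRay_primitive (hβ : β ≠ 0) (hθ : θ ∈ Set.Ioo 0 (Real.pi / 2))
    (h₁ : -(Real.pi / 2) < -β.arg) (h₂ : θ - β.arg < Real.pi / 2) :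
    β⁻¹ * ∫ r in Set.Ioi (0 : ℝ), laplaceRay P.primitive β θ r = P.borelSum β := by
  obtain ⟨K, hK⟩ := P.exists_norm_primitive_le
  obtain ⟨m, hm, hcos⟩ := exists_pos_le_of_continuous (a := 0) (b := θ)
    (f := fun x => Real.cos (x - β.arg)) (by fun_prop)
    fun x hx => Real.cos_pos_of_mem_Ioo ⟨by linarith [hx.1], by linarith [hx.2]⟩
  have hsector : sector 0 θ ⊆ closedQuadrant := by
    rintro _ ⟨x, hx, r, hr, rfl⟩
    exact ray_mem_closedQuadrant ⟨hx.1, hx.2.trans hθ.2.le⟩ hr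
  rw [borelSum, ← integral_laplaceRay_eq hβ hθ.1.le (P.continuousOn_primitive.mono hsector)
    (fun x hx r hr => P.differentiableOn_primitive.differentiableAt (P.isOpen_domain.mem_nhds
      (P.ray_mem_domain ⟨hx.1, by linarith [hx.2, hθ.2, Real.pi_pos]⟩ hr.le))) hK hm hcos]
  simp [laplaceRay, ray_angle_zero]

lemma tendsto_integral_laplaceRay_cauchy_sub (hβ : β ≠ 0) (hθ : θ₁ ≤ θ₂) (h₁ : 0 < θ₁)
    (h₂ : θ₂ < Real.pi) (hβ₁ : |θ₁ - β.arg| ≤ Real.pi / 2) (hβ₂ : |θ₂ - β.arg| ≤ Real.pi / 2) :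
    Tendsto (fun X : ℝ => (∫ r in 0..X, laplaceRay P.cauchy β θ₁ r) -
      ∫ r in 0..X, laplaceRay P.cauchy β θ₂ r) atTop (𝓝 0) := by
  obtain ⟨K, hK⟩ := P.exists_norm_cauchy_le_of_mem_sector h₁ h₂
  refine tendsto_integral_laplaceRay_sub_of_abs_sub_arg_le hβ hθ
    (P.differentiableOn_cauchy.continuousOn.mono (P.sector_subset_domain h₁ h₂))
    (fun θ hmem r hr => P.differentiableOn_cauchy.differentiableAt (P.isOpen_domain.mem_nhds
      (P.ray_mem_domain ⟨h₁.trans hmem.1, hmem.2.trans h₂⟩ hr.le)))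
    (fun t ht => (hK t ht).2) hβ₁ hβ₂

theorem tendsto_integral_laplaceRay_cauchy (hβ : 0 < β.re) (hθ : θ ∈ Set.Ioo 0 Real.pi)
    (hβθ : |θ - β.arg| ≤ Real.pi / 2) :
    Tendsto (fun X : ℝ => ∫ r in 0..X, laplaceRay P.cauchy β θ r) atTop
      (𝓝 ((β ^ 2)⁻¹ * P.borelSum β)) := by
  have hβ0 : β ≠ 0 := by rintro rfl; simp at hβ
  have harg := abs_lt.1 (abs_arg_lt_pi_div_two_iff.2 (Or.inl hβ))
  -- halfway between `arg β` and the imaginary axis every integral converges absolutely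
  set θ₀ : ℝ := Real.pi / 4 + β.arg / 2 with hθ₀
  have hmem : θ₀ ∈ Set.Ioo 0 (Real.pi / 2) := ⟨by linarith, by linarith⟩
  have hmem' : θ₀ ∈ Set.Ioo 0 Real.pi := ⟨hmem.1, by linarith [hmem.2]⟩
  have hcos : 0 < Real.cos (θ₀ - β.arg) :=
    Real.cos_pos_of_mem_Ioo ⟨by linarith, by linarith⟩
  have hβθ₀ : |θ₀ - β.arg| ≤ Real.pi / 2 := abs_le.2 ⟨by linarith, by linarith⟩
  have hvalue : ∫ r in Set.Ioi (0 : ℝ), laplaceRay P.cauchy β θ₀ r =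
      (β ^ 2)⁻¹ * P.borelSum β := by
    rw [P.integral_laplaceRay_cauchy hβ0 hmem' hcos,
      ← P.integral_laplaceRay_primitive hβ0 hmem (by linarith) (by linarith)]
    ring
  have hlim : Tendsto (fun X : ℝ => ∫ r in 0..X, laplaceRay P.cauchy β θ₀ r) atTop
      (𝓝 ((β ^ 2)⁻¹ * P.borelSum β)) := hvalue ▸
    intervalIntegral_tendsto_integral_Ioi 0 (P.integrableOn_laplaceRay_cauchy hβ0 hmem' hcos)
      tendsto_id
  rcases le_total θ θ₀ with hle | hle
  · simpa using (P.tendsto_integral_laplaceRay_cauchy_sub hβ0 hle hθ.1 hmem'.2 hβθ hβθ₀).add hlim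
  · simpa using hlim.sub (P.tendsto_integral_laplaceRay_cauchy_sub hβ0 hle hmem.1 hθ.2 hβθ₀ hβθ)

end RealPoles

/-! ### The poles of the Borel transform -/

lemma hasSum_one_div_add_one_sq :
    HasSum (fun k : ℕ => 1 / ((k : ℂ) + 1) ^ 2) ((Real.pi : ℂ) ^ 2 / 6) := by
  have h := ((hasSum_nat_add_iff' 1).2 hasSum_zeta_two).map ofRealHom continuous_ofReal
  simpa [Function.comp_def] using h

lemma hasSum_cube_div_sq_mul_cotTerm {x : ℂ} (hx : x ∈ integerComplement) :
    HasSum (fun k : ℕ => x ^ 3 / (k + 1) ^ 2 * cotTerm x k)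
      (Real.pi * x * cot (Real.pi * x) - 1 + (Real.pi : ℂ) ^ 2 * x ^ 2 / 3) := by
  have hx0 := integerComplement.ne_zero hx
  have hcot : HasSum (cotTerm x) (Real.pi * cot (Real.pi * x) - 1 / x) :=
    cot_series_rep' hx ▸ (summable_cotTerm hx).hasSum
  convert! (hcot.mul_left x).add (hasSum_one_div_add_one_sq.mul_left (2 * x ^ 2)) using 1
  · ext k
    have hk : (k : ℂ) + 1 ≠ 0 := Nat.cast_add_one_ne_zero k
    have hsub : x - (k + 1) ≠ 0 := by
      simpa [sub_eq_add_neg] using integerComplement_add_ne_zero hx (-(k + 1))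
    have hadd : x + (k + 1) ≠ 0 := by simpa using integerComplement_add_ne_zero hx (k + 1)
    simp only [cotTerm]
    field_simp
    ring
  · field_simp
    ring

lemma hasSum_one_div_add_one_pow {n : ℕ} (hn : n ≠ 0) :
    HasSum (fun k : ℕ => 1 / ((k : ℂ) + 1) ^ (2 * n))
      ((-1) ^ (n + 1) * 2 ^ (2 * n - 1) * (Real.pi : ℂ) ^ (2 * n) *
        ((bernoulli (2 * n) : ℚ) : ℂ) / ((2 * n).factorial : ℂ)) := by
  have h := ((hasSum_nat_add_iff' 1).2 (hasSum_zeta_nat hn)).map ofRealHom continuous_ofReal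
  simpa [Function.comp_def, hn] using h

lemma ofReal_sqrt_pi_sq : ((√Real.pi : ℝ) : ℂ) ^ 2 = Real.pi := by
  rw [← ofReal_pow, Real.sq_sqrt Real.pi_pos.le]

/-- The poles `±k √π / 2`, `k ≥ 1`, of the Borel transform `borelB`; the pair `(k, ±1)` encodes
`±(k + 1) √π / 2`. -/
def borelPoles : RealPoles (ℕ × ℤˣ) where
  pos p := ((p.2 : ℤ) : ℝ) * ((p.1 + 1) * (√Real.pi / 2))
  res p := (1 / (2 * Real.pi ^ 3 * (p.1 + 1) ^ 2) : ℝ)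
  gap := √Real.pi / 2
  gap_pos := by positivity
  gap_le p := by
    have hunit : |((p.2 : ℤ) : ℝ)| = 1 := by rcases Int.units_eq_one_or p.2 with h | h <;> simp [h]
    rw [abs_mul, hunit, one_mul, abs_of_nonneg (by positivity)]
    exact le_mul_of_one_le_left (by positivity) (by simp)
  summable_norm_res := by
    have hsum : Summable fun k : ℕ => 1 / (2 * Real.pi ^ 3 * ((k : ℝ) + 1) ^ 2) := by
      have h := (summable_nat_add_iff 1).2 hasSum_zeta_two.summable
      refine (h.mul_left (1 / (2 * Real.pi ^ 3))).congr fun k => ?_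
      rw [one_div_mul_one_div, Nat.cast_succ]
    have hunits : Summable fun _ : ℤˣ => (1 : ℝ) := .of_finite
    refine (hsum.mul_of_nonneg hunits (fun _ => by positivity)
      fun _ => zero_le_one).congr fun p => ?_
    rw [mul_one, norm_real, Real.norm_of_nonneg (by positivity)]

lemma hasSum_add_neg_one {f : ℕ × ℤˣ → ℂ} {a : ℂ} (hf : HasSum f a) :
    HasSum (fun k => f (k, 1) + f (k, -1)) a :=
  hf.prod_fiberwise fun k => by
    simpa [UnitsInt.univ] using hasSum_fintype fun u : ℤˣ => f (k, u)

lemma two_mul_div_sqrt_pi_mem_integerComplement {t : ℂ} (ht : t ∈ borelPoles.domain)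
    (h0 : t ≠ 0) : 2 * t / (√Real.pi : ℝ) ∈ integerComplement := by
  rintro ⟨n, hn⟩
  have hpi : 0 < √Real.pi := by positivity
  have ht' : t = (n * (√Real.pi / 2) : ℝ) := by
    rw [eq_div_iff (ofReal_ne_zero.2 hpi.ne')] at hn
    push_cast
    linear_combination -hn / 2
  rcases ht with hball | him
  · rw [mem_ball_zero_iff, ht', norm_real, Real.norm_eq_abs, abs_mul,
      abs_of_pos (half_pos hpi)] at hball
    have hlt : |(n : ℝ)| < 1 :=
      lt_of_mul_lt_mul_right (by simpa [borelPoles] using hball) (half_pos hpi).le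
    have hn0 : n = 0 := Int.abs_lt_one_iff.1 (by exact_mod_cast hlt)
    exact h0 (by simpa [hn0] using ht')
  · rw [Set.mem_ofPred_eq, ht', ofReal_im] at him
    exact him.false

lemma borelPoles_res_mul_add {t : ℂ} (k : ℕ) (hx : 2 * t / (√Real.pi : ℝ) ∈ integerComplement) :
    borelPoles.res (k, 1) * (t - borelPoles.pos (k, 1))⁻¹ +
        borelPoles.res (k, -1) * (t - borelPoles.pos (k, -1))⁻¹ =
      (8 * (Real.pi : ℂ) ^ 2 * t ^ 3)⁻¹ * ((2 * t / (√Real.pi : ℝ)) ^ 3 / (k + 1) ^ 2 *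
        cotTerm (2 * t / (√Real.pi : ℝ)) k) := by
  set x := 2 * t / (√Real.pi : ℝ) with hxdef
  have hs : ((√Real.pi : ℝ) : ℂ) ≠ 0 := ofReal_ne_zero.2 (by positivity)
  have ht : t = x * (√Real.pi : ℝ) / 2 := by rw [hxdef]; field_simp
  have hx0 := integerComplement.ne_zero hx
  have hk : (k : ℂ) + 1 ≠ 0 := Nat.cast_add_one_ne_zero k
  have hsub : x - (k + 1) ≠ 0 := by
    simpa [sub_eq_add_neg] using integerComplement_add_ne_zero hx (-(k + 1))
  have hadd : x + (k + 1) ≠ 0 := by simpa using integerComplement_add_ne_zero hx (k + 1)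
  have hsub' : x * (√Real.pi : ℝ) / 2 - (k + 1) * ((√Real.pi : ℝ) / 2) =
    (x - (k + 1)) * ((√Real.pi : ℝ) / 2) := by ring
  have hadd' : x * (√Real.pi : ℝ) / 2 + (k + 1) * ((√Real.pi : ℝ) / 2) =
    (x + (k + 1)) * ((√Real.pi : ℝ) / 2) := by ring
  simp only [borelPoles, cotTerm, ht]
  push_cast
  simp only [one_mul, neg_mul, sub_neg_eq_add, hsub', hadd']
  rw [← ofReal_sqrt_pi_sq]
  field_simp
  ring

theorem eqOn_borelPoles_cauchy : Set.EqOn borelPoles.cauchy borelB borelPoles.domain := by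
  intro t ht
  have hpair := hasSum_add_neg_one
    (borelPoles.iteratedDeriv_three_primitive ht ▸ RealPoles.hasSum_cauchy ht)
  rcases eq_or_ne t 0 with rfl | h0
  · refine hpair.unique ?_
    simp [borelB, borelPoles]
  · have hx := two_mul_div_sqrt_pi_mem_integerComplement ht h0
    simp only [borelPoles_res_mul_add _ hx] at hpair
    refine hpair.unique ?_
    convert! (hasSum_cube_div_sq_mul_cotTerm hx).mul_left (8 * (Real.pi : ℂ) ^ 2 * t ^ 3)⁻¹ using 1
    have hs : ((√Real.pi : ℝ) : ℂ) ≠ 0 := ofReal_ne_zero.2 (by positivity)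
    have harg : Real.pi * (2 * t / (√Real.pi : ℝ)) = 2 * (√Real.pi : ℝ) * t := by
      rw [← ofReal_sqrt_pi_sq]
      field_simp
    rw [harg, ← mul_pow, harg, borelB, mul_pow, mul_pow, ofReal_sqrt_pi_sq]
    ring

lemma borelPoles_taylorTerm_add_of_even {m : ℕ} (hm : Even m) (k : ℕ) :
    -(borelPoles.res (k, 1) * ((borelPoles.pos (k, 1) : ℂ) ^ (m + 1))⁻¹) +
      -(borelPoles.res (k, -1) * ((borelPoles.pos (k, -1) : ℂ) ^ (m + 1))⁻¹) = 0 := by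
  simp [borelPoles, hm.add_one.neg_pow]

lemma borelPoles_taylorTerm_add_of_odd (j k : ℕ) :
    -(borelPoles.res (k, 1) * ((borelPoles.pos (k, 1) : ℂ) ^ (2 * j + 1 + 1))⁻¹) +
      -(borelPoles.res (k, -1) * ((borelPoles.pos (k, -1) : ℂ) ^ (2 * j + 1 + 1))⁻¹) =
        -(1 / Real.pi ^ 3 * (4 / Real.pi) ^ (j + 1)) * (1 / ((k : ℂ) + 1) ^ (2 * (j + 2))) := by
  have hk : (k : ℂ) + 1 ≠ 0 := Nat.cast_add_one_ne_zero k
  have hpow : 2 * j + 1 + 1 = 2 * (j + 1) := by ring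
  have hpos : (((k : ℂ) + 1) * ((√Real.pi : ℝ) / 2)) ^ (2 * (j + 1)) =
      ((k + 1) ^ 2 * (Real.pi / 4)) ^ (j + 1) := by
    rw [pow_mul, mul_pow, div_pow, ofReal_sqrt_pi_sq]
    norm_num
  simp only [borelPoles, hpow]
  push_cast
  simp only [one_mul, neg_mul, (even_two_mul (j + 1)).neg_pow, hpos]
  rw [show 2 * (j + 2) = 2 * (j + 1) + 2 by ring, pow_add _ (2 * (j + 1)), pow_mul]
  simp only [div_pow, mul_pow]
  field_simp
  ring

lemma coeffA_add_two (j : ℕ) :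
    coeffA (j + 2) = (2 * j + 1).factorial * (-(1 / Real.pi ^ 3 * (4 / Real.pi) ^ (j + 1)) *
      ((-1) ^ (j + 2 + 1) * 2 ^ (2 * (j + 2) - 1) * (Real.pi : ℂ) ^ (2 * (j + 2)) *
        ((bernoulli (2 * (j + 2)) : ℚ) : ℂ) / ((2 * (j + 2)).factorial : ℂ))) := by
  have hsub : 2 * (j + 2) - 3 = 2 * j + 1 := by omega
  have hsub' : 2 * (j + 2) - 1 = 2 * (j + 1) + 1 := by omega
  have hpi : (Real.pi : ℂ) ≠ 0 := ofReal_ne_zero.2 Real.pi_ne_zero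
  have hfact : ((2 * (j + 2)).factorial : ℂ) ≠ 0 := Nat.cast_ne_zero.2 (Nat.factorial_ne_zero _)
  have hbase : -16 * (Real.pi : ℂ) = -1 * (2 ^ 4 * Real.pi) := by ring
  have hfour : (4 : ℂ) = 2 ^ 2 := by norm_num
  rw [coeffA, hsub, hsub', hbase, hfour, div_pow, mul_pow, mul_pow, ← pow_mul, ← pow_mul]
  field_simp
  ring

lemma iteratedDeriv_borelPoles_cauchy_zero (m : ℕ) :
    iteratedDeriv m borelPoles.cauchy 0 = seriesShifted m := by
  rw [RealPoles.iteratedDeriv_cauchy_zero, seriesShifted]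
  have hpair := hasSum_add_neg_one (borelPoles.hasSum_taylorCoeff m)
  split_ifs with hm
  · obtain ⟨j, rfl⟩ := hm
    have hindex : (2 * j + 1 + 3) / 2 = j + 2 := by omega
    simp only [borelPoles_taylorTerm_add_of_odd] at hpair
    rw [hindex, coeffA_add_two,
      hpair.unique ((hasSum_one_div_add_one_pow (Nat.succ_ne_zero _)).mul_left _)]
  · simp only [borelPoles_taylorTerm_add_of_even (Nat.not_odd_iff_even.1 hm)] at hpair
    rw [hpair.unique hasSum_zero, mul_zero]

lemma seriesFull_of_lt {n : ℕ} (hn : n < 3) : seriesFull n = 0 := if_neg (by omega)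

lemma seriesFull_add_three (m : ℕ) : seriesFull (m + 3) = seriesShifted m := by
  refine if_congr ?_ rfl rfl
  rw [Nat.even_iff, Nat.odd_iff]
  omega

theorem isBorelContinuation_borelB : IsBorelContinuation seriesShifted borelB := by
  have h : borelPoles.cauchy =ᶠ[𝓝 0] borelB :=
    eqOn_borelPoles_cauchy.eventuallyEq_of_mem
      (borelPoles.isOpen_domain.mem_nhds borelPoles.zero_mem_domain)
  exact isBorelContinuation_of_iteratedDeriv borelPoles.gap_pos
    (borelPoles.differentiableOn_cauchy.congr fun _ ht => (eqOn_borelPoles_cauchy ht).symm)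
    fun m => by rw [← h.iteratedDeriv_eq, iteratedDeriv_borelPoles_cauchy_zero]

theorem isBorelContinuation_borelPoles_primitive :
    IsBorelContinuation seriesFull borelPoles.primitive := by
  refine isBorelContinuation_of_iteratedDeriv borelPoles.gap_pos
    borelPoles.differentiableOn_primitive fun n => ?_
  rcases lt_or_ge n 3 with hn | hn
  · rw [borelPoles.iteratedDeriv_primitive_zero hn, seriesFull_of_lt hn]
  · obtain ⟨m, rfl⟩ := Nat.exists_eq_add_of_le' hn
    rw [borelPoles.iteratedDeriv_add_three_primitive_zero, iteratedDeriv_borelPoles_cauchy_zero,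
      seriesFull_add_three]

/-! ### The effective action as a Laplace integral -/

lemma ray_arg_add (β : ℂ) (ψ s : ℝ) : ray (β.arg + ψ) (‖β‖ * s) = β * ray ψ s := by
  conv_rhs => rw [← norm_mul_exp_arg_mul_I β]
  simp only [ray, ofReal_mul, ofReal_add, add_mul, exp_add]
  ring

lemma norm_mul_laplaceRay (h : ℂ → ℂ) {β : ℂ} (hβ : β ≠ 0) (ψ s : ℝ) :
    ‖β‖ * laplaceRay h β (β.arg + ψ) (‖β‖ * s) =
      β * (h (β * ray ψ s) * exp (-ray ψ s) * exp (ψ * I)) := by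
  rw [laplaceRay, ray_arg_add, neg_div, mul_div_cancel_left₀ _ hβ, ofReal_add, add_mul, exp_add]
  linear_combination (h (β * ray ψ s) * exp (-ray ψ s) * exp (ψ * I)) * norm_mul_exp_arg_mul_I β

lemma cot_mul_I (z : ℂ) : cot (z * I) = -I * (cosh z / sinh z) := by
  rw [cot, cos_mul_I, sin_mul_I, div_mul_eq_div_div, div_I]
  ring

lemma cpow_pi_mul_sq {β : ℂ} (hβ : 0 < β.re) :
    ((Real.pi : ℂ) * β ^ 2) ^ (1 / 2 : ℂ) = (√Real.pi : ℝ) * β := by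
  rw [← ofReal_sqrt_pi_sq, ← mul_pow, one_div, sq_cpow_two_inv]
  rw [re_ofReal_mul]
  positivity

lemma actionIntegrand_sq {β : ℂ} (hβ : 0 < β.re) (s : ℝ) :
    actionIntegrand (β ^ 2) s =
      -(8 * (Real.pi : ℂ) ^ 2) * β ^ 3 * (borelB (β * (s * I)) * exp (-(s * I)) * I) := by
  rcases eq_or_ne s 0 with rfl | hs
  · simp [actionIntegrand, borelB]
  have hs0 : (s : ℂ) ≠ 0 := ofReal_ne_zero.2 hs
  have hβ0 : β ≠ 0 := by rintro rfl; simp at hβ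
  have hpi : (Real.pi : ℂ) ≠ 0 := ofReal_ne_zero.2 Real.pi_ne_zero
  have harg : 2 * (√Real.pi : ℝ) * (β * (s * I)) = 2 * ((√Real.pi : ℝ) * β) * s * I := by ring
  have hcube : (β * (s * I)) ^ 3 = -(β ^ 3 * s ^ 3 * I) := by
    rw [mul_pow, mul_pow, I_pow_three]
    ring
  rw [actionIntegrand, cpow_pi_mul_sq hβ, borelB, harg, cot_mul_I, hcube, mul_comm (s : ℂ) I]
  field_simp
  ring_nf
  simp only [I_sq]
  ring

lemma rotatedIntegrand_eq {β : ℂ} (hβ : β ≠ 0) (t : ℝ) :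
    rotatedIntegrand β t = 8 * (Real.pi : ℂ) ^ 2 * β ^ 3 * (borelB (β * t) * exp (-t)) := by
  rcases eq_or_ne t 0 with rfl | ht
  · simp [rotatedIntegrand, borelB]
  have ht0 : (t : ℂ) ≠ 0 := ofReal_ne_zero.2 ht
  have hpi : (Real.pi : ℂ) ≠ 0 := ofReal_ne_zero.2 Real.pi_ne_zero
  rw [rotatedIntegrand, borelB]
  field_simp

lemma actionIntegrand_eq_laplaceRay {β : ℂ} (hβ : 0 < β.re) {s : ℝ} (hs : 0 ≤ s) :
    -(1 / (8 * (Real.pi : ℂ) ^ 2)) * actionIntegrand (β ^ 2) s =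
      β ^ 2 * (‖β‖ * laplaceRay borelPoles.cauchy β (β.arg + Real.pi / 2) (‖β‖ * s)) := by
  have hβ0 : β ≠ 0 := by rintro rfl; simp at hβ
  have hpi : (Real.pi : ℂ) ≠ 0 := ofReal_ne_zero.2 Real.pi_ne_zero
  have harg := abs_lt.1 (abs_arg_lt_pi_div_two_iff.2 (Or.inl hβ))
  have hmem := borelPoles.ray_mem_domain (θ := β.arg + Real.pi / 2)
    ⟨by linarith, by linarith⟩ (mul_nonneg (norm_nonneg β) hs)
  rw [ray_arg_add] at hmem
  have hI : exp (((Real.pi / 2 : ℝ) : ℂ) * I) = I := by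
    rw [ofReal_div, ofReal_ofNat, exp_pi_div_two_mul_I]
  rw [actionIntegrand_sq hβ, norm_mul_laplaceRay _ hβ0, eqOn_borelPoles_cauchy hmem, ray, hI]
  field_simp

lemma rotatedIntegrand_eq_laplaceRay {β : ℂ} (hβ : β.arg ∈ Set.Ioo 0 Real.pi) {t : ℝ}
    (ht : 0 ≤ t) :
    1 / (8 * (Real.pi : ℂ) ^ 2) * rotatedIntegrand β t =
      β ^ 2 * (‖β‖ * laplaceRay borelPoles.cauchy β β.arg (‖β‖ * t)) := by
  have hβ0 : β ≠ 0 := by rintro rfl; simp at hβ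
  have hpi : (Real.pi : ℂ) ≠ 0 := ofReal_ne_zero.2 Real.pi_ne_zero
  have hmem := borelPoles.ray_mem_domain hβ (mul_nonneg (norm_nonneg β) ht)
  have hpolar := norm_mul_laplaceRay borelPoles.cauchy hβ0 0 t
  rw [← add_zero β.arg, ray_arg_add, ray_angle_zero] at hmem
  rw [add_zero, ray_angle_zero, eqOn_borelPoles_cauchy hmem, ofReal_zero, zero_mul, exp_zero,
    mul_one] at hpolar
  rw [rotatedIntegrand_eq hβ0, hpolar]
  field_simp

lemma tendsto_actionPartial_borelSum {β : ℂ} (hβ : 0 < β.re) :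
    Tendsto (actionPartial (β ^ 2)) atTop (𝓝 (borelPoles.borelSum β)) := by
  have hβ0 : β ≠ 0 := by rintro rfl; simp at hβ
  have harg := abs_lt.1 (abs_arg_lt_pi_div_two_iff.2 (Or.inl hβ))
  have hscale : Tendsto (fun X : ℝ => ‖β‖ * X) atTop atTop :=
    tendsto_id.const_mul_atTop (norm_pos_iff.2 hβ0)
  have hlim := ((borelPoles.tendsto_integral_laplaceRay_cauchy hβ
    (θ := β.arg + Real.pi / 2) ⟨by linarith, by linarith⟩
    (by rw [add_sub_cancel_left, abs_of_pos (by positivity)])).comp hscale).const_mul (β ^ 2)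
  rw [mul_inv_cancel_left₀ (pow_ne_zero 2 hβ0)] at hlim
  refine hlim.congr' ?_
  filter_upwards [eventually_ge_atTop 0] with X hX
  have hpoint : Set.EqOn (fun s => -(1 / (8 * (Real.pi : ℂ) ^ 2)) * actionIntegrand (β ^ 2) s)
      (fun s => β ^ 2 * (‖β‖ * laplaceRay borelPoles.cauchy β (β.arg + Real.pi / 2) (‖β‖ * s)))
      (Set.uIcc 0 X) := fun s hs =>
    actionIntegrand_eq_laplaceRay hβ (Set.uIcc_of_le hX ▸ hs).1
  rw [actionPartial, Function.comp_apply, ← intervalIntegral.integral_const_mul (-_),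
    intervalIntegral.integral_congr hpoint, intervalIntegral.integral_const_mul,
    intervalIntegral.integral_const_mul, ← real_smul,
    intervalIntegral.smul_integral_comp_mul_left, mul_zero]

theorem Phi_eq_borelSum {β : ℂ} (hβ : 0 < β.re) : Phi β = borelPoles.borelSum β :=
  (tendsto_actionPartial_borelSum hβ).limUnder_eq

theorem tendsto_actionPartial {β : ℂ} (hβ : 0 < β.re) :
    Tendsto (actionPartial (β ^ 2)) atTop (𝓝 (Phi β)) :=
  Phi_eq_borelSum hβ ▸ tendsto_actionPartial_borelSum hβ

theorem integrableOn_rotatedIntegrand {β : ℂ} (hβ : β.arg ∈ Set.Ioo 0 Real.pi) :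
    IntegrableOn (rotatedIntegrand β) (Set.Ioi 0) := by
  have hβ0 : β ≠ 0 := by rintro rfl; simp at hβ
  have hint : IntegrableOn (fun t => laplaceRay borelPoles.cauchy β β.arg (‖β‖ * t))
      (Set.Ioi 0) := by
    rw [integrableOn_Ioi_comp_mul_left_iff _ 0 (norm_pos_iff.2 hβ0), mul_zero]
    exact borelPoles.integrableOn_laplaceRay_cauchy hβ0 hβ (by simp)
  refine IntegrableOn.congr_fun
    (((hint.const_mul (‖β‖ : ℂ)).const_mul (β ^ 2)).const_mul (8 * (Real.pi : ℂ) ^ 2))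
    (fun t ht => ?_) measurableSet_Ioi
  have hpi : (Real.pi : ℂ) ≠ 0 := ofReal_ne_zero.2 Real.pi_ne_zero
  rw [← rotatedIntegrand_eq_laplaceRay hβ (le_of_lt ht)]
  field_simp

theorem Phi_eq_integral_rotatedIntegrand {β : ℂ} (hβ : β.arg ∈ Set.Ioo 0 (Real.pi / 2)) :
    Phi β = 1 / (8 * (Real.pi : ℂ) ^ 2) * ∫ t in Set.Ioi (0 : ℝ), rotatedIntegrand β t := by
  have hβ0 : β ≠ 0 := by rintro rfl; simp at hβ
  have hnorm : (‖β‖ : ℂ) ≠ 0 := ofReal_ne_zero.2 (norm_ne_zero_iff.2 hβ0)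
  have hre : 0 < β.re := (abs_arg_lt_pi_div_two_iff.1
    (abs_lt.2 ⟨by linarith [hβ.1, Real.pi_pos], hβ.2⟩)).resolve_right hβ0
  have hθ : β.arg ∈ Set.Ioo 0 Real.pi := ⟨hβ.1, by linarith [hβ.2, Real.pi_pos]⟩
  have hvalue : ∫ r in Set.Ioi 0, laplaceRay borelPoles.cauchy β β.arg r =
      (β ^ 2)⁻¹ * borelPoles.borelSum β :=
    tendsto_nhds_unique (intervalIntegral_tendsto_integral_Ioi 0
        (borelPoles.integrableOn_laplaceRay_cauchy hβ0 hθ (by simp)) tendsto_id)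
      (borelPoles.tendsto_integral_laplaceRay_cauchy hre hθ
        (by rw [sub_self, abs_zero]; positivity))
  rw [← integral_const_mul, setIntegral_congr_fun measurableSet_Ioi fun t ht =>
      rotatedIntegrand_eq_laplaceRay hθ (le_of_lt ht), integral_const_mul, integral_const_mul,
    integral_comp_mul_left_Ioi _ _ (norm_pos_iff.2 hβ0), mul_zero, hvalue, Phi_eq_borelSum hre,
    real_smul, ofReal_inv]
  field_simp

/-! ### Distributional derivatives and boundary values -/

section Derivative

variable {F : Type*} [NormedAddCommGroup F] [NormedSpace ℝ F]

lemma coe_testFunction_lineDerivCLM (φ : 𝓓((⊤ : Opens ℝ), F)) :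
    ⇑(TestFunction.lineDerivCLM ℝ (1 : ℝ) φ : 𝓓((⊤ : Opens ℝ), F)) = deriv φ := by
  ext t
  refine (TestFunction.lineDerivCLM_apply_of_le (𝕜 := ℝ) (n := ⊤) (k := ⊤) le_top).trans ?_
  simp [lineDeriv, deriv_comp_const_add]

lemma differentiable_testFunction (φ : 𝓓((⊤ : Opens ℝ), F)) : Differentiable ℝ φ :=
  φ.contDiff.differentiable (by simp)

end Derivative

/-- The distributional derivative `⟨T', φ⟩ = -⟨T, φ'⟩`. -/
def distrDeriv (T : Distr) : Distr := Distribution.lineDerivCLM (1 : ℝ) T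

lemma distrDeriv_apply (T : Distr) (φ : 𝓓((⊤ : Opens ℝ), ℝ)) :
    distrDeriv T φ = -T (TestFunction.lineDerivCLM ℝ (1 : ℝ) φ) :=
  Distribution.lineDerivCLM_apply

lemma postcompCLM_testFunction_lineDerivCLM (A : ℂ →L[ℝ] ℝ) (ψ : 𝓓((⊤ : Opens ℝ), ℂ)) :
    (TestFunction.lineDerivCLM ℝ (1 : ℝ) (TestFunction.postcompCLM A ψ) : 𝓓((⊤ : Opens ℝ), ℝ)) =
      TestFunction.postcompCLM A (TestFunction.lineDerivCLM ℝ (1 : ℝ) ψ) := by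
  ext t
  rw [coe_testFunction_lineDerivCLM, TestFunction.postcompCLM_apply, TestFunction.postcompCLM_apply,
    Function.comp_apply, coe_testFunction_lineDerivCLM]
  exact (A.hasFDerivAt.comp_hasDerivAt t (differentiable_testFunction ψ t).hasDerivAt).deriv

lemma pairing_distrDeriv (T : Distr) (ψ : 𝓓((⊤ : Opens ℝ), ℂ)) :
    pairing (distrDeriv T) ψ = -pairing T (TestFunction.lineDerivCLM ℝ (1 : ℝ) ψ) := by
  simp only [pairing, distrDeriv_apply, postcompCLM_testFunction_lineDerivCLM]
  ring

lemma pairing_add (T : Distr) (ψ₁ ψ₂ : 𝓓((⊤ : Opens ℝ), ℂ)) :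
    pairing T (ψ₁ + ψ₂) = pairing T ψ₁ + pairing T ψ₂ := by
  simp only [pairing, map_add]
  ring

lemma pairing_smul (T : Distr) (w : ℂ) (ψ : 𝓓((⊤ : Opens ℝ), ℂ)) :
    pairing T (w • ψ) = w * pairing T ψ := by
  have hre : TestFunction.postcompCLM reCLM (w • ψ) =
      w.re • TestFunction.postcompCLM reCLM ψ - w.im • TestFunction.postcompCLM imCLM ψ := by
    ext t
    exact mul_re w (ψ t)
  have him : TestFunction.postcompCLM imCLM (w • ψ) =
      w.re • TestFunction.postcompCLM imCLM ψ + w.im • TestFunction.postcompCLM reCLM ψ := by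
    ext t
    exact mul_im w (ψ t)
  simp only [pairing, hre, him, map_add, map_sub, map_smul, real_smul]
  linear_combination (T (TestFunction.postcompCLM reCLM ψ) +
    I * T (TestFunction.postcompCLM imCLM ψ)) * re_add_im w -
      w.im * T (TestFunction.postcompCLM imCLM ψ) * I_sq

lemma lineDerivCLM_expTest (χ : 𝓓((⊤ : Opens ℝ), ℝ)) (z : ℂ) :
    TestFunction.lineDerivCLM ℝ (1 : ℝ) (expTest χ z) =
      expTest (TestFunction.lineDerivCLM ℝ (1 : ℝ) χ) z + (-z⁻¹) • expTest χ z := by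
  ext t
  have hχ := (differentiable_testFunction χ t).hasDerivAt.ofReal_comp
  have hexp : HasDerivAt (fun t : ℝ => exp (-(t : ℂ) / z)) (exp (-(t : ℂ) / z) * (-1 / z)) t := by
    simpa using (((hasDerivAt_id t).ofReal_comp.neg).div_const z).cexp
  rw [coe_testFunction_lineDerivCLM]
  refine (hχ.mul hexp).deriv.trans ?_
  change _ = ((TestFunction.lineDerivCLM ℝ (1 : ℝ) χ : 𝓓((⊤ : Opens ℝ), ℝ)) t : ℂ) *
    exp (-(t : ℂ) / z) + -z⁻¹ * ((χ t : ℂ) * exp (-(t : ℂ) / z))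
  rw [coe_testFunction_lineDerivCLM]
  ring

lemma expTest_add (χ₁ χ₂ : 𝓓((⊤ : Opens ℝ), ℝ)) (z : ℂ) :
    expTest (χ₁ + χ₂) z = expTest χ₁ z + expTest χ₂ z := by
  ext t
  change ((χ₁ t + χ₂ t : ℝ) : ℂ) * exp (-(t : ℂ) / z) = (χ₁ t : ℂ) * exp (-(t : ℂ) / z) +
    (χ₂ t : ℂ) * exp (-(t : ℂ) / z)
  rw [ofReal_add, add_mul]

lemma IsApproxUnit.add_lineDerivCLM {χ : ℕ → 𝓓((⊤ : Opens ℝ), ℝ)} (hχ : IsApproxUnit χ) :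
    IsApproxUnit fun k =>
      χ k + (TestFunction.lineDerivCLM ℝ (1 : ℝ) (χ k) : 𝓓((⊤ : Opens ℝ), ℝ)) where
  bounded n := by
    obtain ⟨M, hM⟩ := hχ.bounded n
    obtain ⟨M', hM'⟩ := hχ.bounded (n + 1)
    refine ⟨M + M', fun k t => ?_⟩
    have hderiv : ContDiff ℝ ∞ (deriv (χ k)) := (contDiff_infty_iff_deriv.1 (χ k).contDiff).2
    change |iteratedDeriv n (⇑(χ k) + ⇑(TestFunction.lineDerivCLM ℝ (1 : ℝ) (χ k))) t| ≤ _
    rw [coe_testFunction_lineDerivCLM,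
      iteratedDeriv_add ((χ k).contDiff.contDiffAt.of_le (by exact_mod_cast le_top))
        (hderiv.contDiffAt.of_le (by exact_mod_cast le_top)), ← iteratedDeriv_succ']
    exact (abs_add_le _ _).trans (add_le_add (hM k t) (hM' k t))
  eventually_one r := by
    filter_upwards [hχ.eventually_one (r + 1)] with k hk t ht
    have hconst : χ k =ᶠ[𝓝 t] fun _ => 1 := by
      filter_upwards [(isOpen_lt continuous_abs continuous_const).mem_nhds
        (show |t| < r + 1 by linarith)] with s hs using hk s hs.le
    change χ k t + (TestFunction.lineDerivCLM ℝ (1 : ℝ) (χ k) : 𝓓((⊤ : Opens ℝ), ℝ)) t = 1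
    rw [coe_testFunction_lineDerivCLM, hconst.deriv_eq, hk t (by linarith), deriv_const, add_zero]

/-- Since `χ` and `χ + χ'` are both approximate units, the terms `⟨T, χ' e^{-t/z}⟩` tend to zero. -/
theorem HasLaplaceIntegral.distrDeriv {T : Distr} {z L : ℂ} (h : HasLaplaceIntegral T z L) :
    HasLaplaceIntegral (distrDeriv T) z (z⁻¹ * L) := by
  intro χ hχ
  have hcut : Tendsto (fun k => pairing T (expTest (TestFunction.lineDerivCLM ℝ (1 : ℝ) (χ k)) z))
      atTop (𝓝 0) := by
    simpa only [expTest_add, pairing_add, add_sub_cancel_left, sub_self] using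
      (h _ hχ.add_lineDerivCLM).sub (h χ hχ)
  simpa only [pairing_distrDeriv, lineDerivCLM_expTest, pairing_add, pairing_smul, neg_mul, neg_add,
    neg_neg, neg_zero, zero_add] using hcut.neg.add ((h χ hχ).const_mul z⁻¹)

theorem HasLaplaceBorel.iterate_distrDeriv {T : Distr} {z w : ℂ} (h : HasLaplaceBorel T z w) :
    ∀ j : ℕ, HasLaplaceBorel (VacPol.distrDeriv^[j] T) z ((z ^ j)⁻¹ * w)
  | 0 => by simpa using h
  | j + 1 => by
    obtain ⟨L, hL, hw⟩ := h.iterate_distrDeriv j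
    rw [Function.iterate_succ_apply']
    refine ⟨_, hL.distrDeriv, ?_⟩
    rw [← hw, pow_succ', mul_inv, mul_assoc]

lemma integral_Ioi_deriv_mul_testFunction {f f' : ℝ → ℂ} (hf : ∀ t, HasDerivAt f (f' t) t)
    (φ : 𝓓((⊤ : Opens ℝ), ℝ)) (hint : IntegrableOn (fun t => f' t * (φ t : ℂ)) (Set.Ioi 0))
    (hint' : IntegrableOn (fun t => f t * ((deriv φ t : ℝ) : ℂ)) (Set.Ioi 0)) :
    ∫ t in Set.Ioi (0 : ℝ), f' t * (φ t : ℂ) =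
      -(f 0 * φ 0) - ∫ t in Set.Ioi (0 : ℝ), f t * ((deriv φ t : ℝ) : ℂ) := by
  have hderiv (t : ℝ) : HasDerivAt (fun t => f t * (φ t : ℂ))
      (f' t * (φ t : ℂ) + f t * ((deriv φ t : ℝ) : ℂ)) t :=
    (hf t).mul (differentiable_testFunction φ t).hasDerivAt.ofReal_comp
  have hvanish : Tendsto (fun t => f t * (φ t : ℂ)) atTop (𝓝 0) := by
    refine tendsto_const_nhds.congr' ?_
    filter_upwards [(hasCompactSupport_iff_eventuallyEq.1 φ.hasCompactSupport).filter_mono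
      (coclosedCompact_eq_cocompact (X := ℝ) ▸ atTop_le_cocompact)] with t ht
    rw [ht, Pi.zero_apply, ofReal_zero, mul_zero]
  have hftc := integral_Ioi_of_hasDerivAt_of_tendsto (hderiv 0).continuousAt.continuousWithinAt
    (fun t _ => hderiv t) (hint.add hint') hvanish
  rw [integral_add hint hint'] at hftc
  linear_combination hftc

/-- The boundary term of the integration by parts is `G(iε) φ(0)`. -/
theorem IsBoundaryValue.distrDeriv {G : ℂ → ℂ} {T : Distr} (h : IsBoundaryValue G T)
    (hG : DifferentiableOn ℂ G {t | 0 < t.im})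
    (h0 : Tendsto (fun ε : ℝ => G (ε * I)) (𝓝[>] 0) (𝓝 0)) :
    IsBoundaryValue (deriv G) (distrDeriv T) := by
  intro φ
  have hopen : IsOpen {t : ℂ | 0 < t.im} := isOpen_lt continuous_const continuous_im
  have hmem : ∀ {ε : ℝ}, 0 < ε → ∀ t : ℝ, (t + ε * I : ℂ) ∈ {t : ℂ | 0 < t.im} := fun hε t => by
    simpa using hε
  have hint : ∀ {ε : ℝ}, 0 < ε →
      IntegrableOn (fun t : ℝ => deriv G (t + ε * I) * (φ t : ℂ)) (Set.Ioi 0) := fun {ε} hε => by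
    have hcont : Continuous fun t : ℝ => deriv G (t + ε * I) * (φ t : ℂ) :=
      ((hG.deriv hopen).continuousOn.comp_continuous (by fun_prop) (hmem hε)).mul
        (continuous_ofReal.comp φ.continuous)
    exact (hcont.integrable_of_hasCompactSupport
      (φ.hasCompactSupport.comp_left (g := ((↑) : ℝ → ℂ)) ofReal_zero).mul_left).integrableOn
  refine ⟨eventually_mem_nhdsWithin.mono fun ε hε => hint hε, ?_⟩
  have hφ' := h (TestFunction.lineDerivCLM ℝ (1 : ℝ) φ)
  have hlim := (h0.mul_const (φ 0 : ℂ)).neg.sub hφ'.2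
  rw [zero_mul, neg_zero, zero_sub, ← distrDeriv_apply] at hlim
  refine hlim.congr' ?_
  rw [coe_testFunction_lineDerivCLM] at hφ' ⊢
  filter_upwards [self_mem_nhdsWithin, hφ'.1] with ε hε hint'
  have hline (t : ℝ) : HasDerivAt (fun t : ℝ => G (t + ε * I)) (deriv G (t + ε * I)) t := by
    refine (HasDerivAt.comp (h₂ := G) t (hG.hasDerivAt (hopen.mem_nhds (hmem hε t)))
      ((hasDerivAt_id t).ofReal_comp.add_const (ε * I : ℂ))).congr_deriv ?_
    rw [ofReal_one, mul_one, id]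
  simpa using (integral_Ioi_deriv_mul_testFunction hline φ (hint hε) hint').symm

theorem IsBoundaryValue.iterate_distrDeriv {G : ℂ → ℂ} {T : Distr} (h : IsBoundaryValue G T)
    (hG : DifferentiableOn ℂ G {t | 0 < t.im}) :
    ∀ j : ℕ, (∀ i < j, Tendsto (fun ε : ℝ => iteratedDeriv i G (ε * I)) (𝓝[>] 0) (𝓝 0)) →
      IsBoundaryValue (iteratedDeriv j G) (VacPol.distrDeriv^[j] T)
  | 0, _ => by simpa using h
  | j + 1, h0 => by
    have hopen : IsOpen {t : ℂ | 0 < t.im} := isOpen_lt continuous_const continuous_im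
    rw [iteratedDeriv_succ, Function.iterate_succ_apply']
    exact (h.iterate_distrDeriv hG j fun i hi => h0 i (hi.trans j.lt_succ_self)).distrDeriv
      (fun t ht => (hasDerivAt_iteratedDeriv hG hopen j ht).differentiableAt.differentiableWithinAt)
      (h0 j j.lt_succ_self)

lemma IsBoundaryValue.congr {B B' : ℂ → ℂ} {T : Distr} (h : IsBoundaryValue B T)
    (heq : Set.EqOn B B' {t | 0 < t.im}) : IsBoundaryValue B' T := by
  intro φ
  have hφ : ∀ᶠ ε : ℝ in 𝓝[>] 0, (fun t : ℝ => B (t + ε * I) * (φ t : ℂ)) =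
      fun t : ℝ => B' (t + ε * I) * (φ t : ℂ) := by
    filter_upwards [self_mem_nhdsWithin] with ε hε
    ext t
    rw [heq (by simpa using hε)]
  refine ⟨((h φ).1.and hφ).mono fun ε hε => hε.2 ▸ hε.1, (h φ).2.congr' (hφ.mono fun ε hε => ?_)⟩
  rw [hε]

/-- The distribution `φ ↦ ∫_0^∞ φ(t) g(t) dt`. -/
def halfLineDistr (g : ℝ → ℂ) : Distr :=
  TestFunction.integralAgainstBilinCLM (ContinuousLinearMap.lsmul ℝ ℝ : ℝ →L[ℝ] ℂ →L[ℝ] ℂ)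
    (volume.restrict (Set.Ioi 0)) g

section HalfLineDistr

variable {g : ℝ → ℂ}

lemma locallyIntegrable_restrict_Ioi (hg : ContinuousOn g (Set.Ici 0)) :
    LocallyIntegrable g (volume.restrict (Set.Ioi 0)) := by
  rw [locallyIntegrable_iff]
  intro K hK
  rw [IntegrableOn, Measure.restrict_restrict hK.measurableSet]
  have h : IntegrableOn g (K ∩ Set.Ici 0) :=
    (hg.mono Set.inter_subset_right).integrableOn_compact (hK.inter_right isClosed_Ici)
  exact h.mono_set (Set.inter_subset_inter_right _ Set.Ioi_subset_Ici_self)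

lemma halfLineDistr_apply (hg : ContinuousOn g (Set.Ici 0)) (φ : 𝓓((⊤ : Opens ℝ), ℝ)) :
    halfLineDistr g φ = ∫ t in Set.Ioi (0 : ℝ), (φ t : ℂ) * g t := by
  have h : halfLineDistr g φ = ∫ t in Set.Ioi (0 : ℝ), φ t • g t :=
    TestFunction.integralAgainstBilinCLM_eq_integral
      ((locallyIntegrable_restrict_Ioi hg).locallyIntegrableOn _)
  simpa only [real_smul] using h

lemma integrableOn_testFunction_mul (hg : ContinuousOn g (Set.Ici 0))
    (φ : 𝓓((⊤ : Opens ℝ), ℝ)) :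
    IntegrableOn (fun t => (φ t : ℂ) * g t) (Set.Ioi 0) :=
  (locallyIntegrable_restrict_Ioi hg).integrable_smul_left_of_hasCompactSupport
    φ.continuous φ.hasCompactSupport

lemma pairing_halfLineDistr (hg : ContinuousOn g (Set.Ici 0)) (ψ : 𝓓((⊤ : Opens ℝ), ℂ)) :
    pairing (halfLineDistr g) ψ = ∫ t in Set.Ioi (0 : ℝ), ψ t * g t := by
  rw [pairing, halfLineDistr_apply hg, halfLineDistr_apply hg, ← integral_const_mul,
    ← integral_add (integrableOn_testFunction_mul hg _)
      ((integrableOn_testFunction_mul hg _).const_mul I)]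
  refine integral_congr_ae (Eventually.of_forall fun t => ?_)
  change ((ψ t).re : ℂ) * g t + I * (((ψ t).im : ℂ) * g t) = ψ t * g t
  linear_combination g t * re_add_im (ψ t)

theorem hasLaplaceIntegral_halfLineDistr (hg : ContinuousOn g (Set.Ici 0)) {z : ℂ}
    (hint : IntegrableOn (fun t : ℝ => g t * exp (-(t : ℂ) / z)) (Set.Ioi 0)) :
    HasLaplaceIntegral (halfLineDistr g) z
      (∫ t in Set.Ioi (0 : ℝ), g t * exp (-(t : ℂ) / z)) := by
  intro χ hχ
  obtain ⟨M, hM⟩ := hχ.bounded 0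
  have hfun : ∀ k (t : ℝ), expTest (χ k) z t * g t = (χ k t : ℂ) * (g t * exp (-(t : ℂ) / z)) :=
    fun k t => (mul_right_comm _ _ _).trans (mul_assoc _ _ _)
  simp only [pairing_halfLineDistr hg, hfun]
  refine tendsto_integral_of_dominated_convergence (fun t => M * ‖g t * exp (-(t : ℂ) / z)‖)
    (fun k => (continuous_ofReal.comp (χ k).continuous).aestronglyMeasurable.mul
      hint.aestronglyMeasurable) (hint.norm.const_mul M)
    (fun k => Eventually.of_forall fun t => ?_) (Eventually.of_forall fun t => ?_)
  · rw [norm_mul, norm_real, Real.norm_eq_abs]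
    exact mul_le_mul_of_nonneg_right (by simpa using hM k t) (norm_nonneg _)
  · refine tendsto_const_nhds.congr' ?_
    filter_upwards [hχ.eventually_one |t|] with k hk
    rw [hk t le_rfl, ofReal_one, one_mul]

end HalfLineDistr

section ContinuousBoundary

variable {G : ℂ → ℂ}

lemma add_mul_I_mem_closedQuadrant {t ε : ℝ} (ht : 0 ≤ t) (hε : 0 ≤ ε) :
    (t + ε * I : ℂ) ∈ closedQuadrant := by
  simp [closedQuadrant, ht, hε]

lemma continuousOn_ofReal_of_closedQuadrant (hG : ContinuousOn G closedQuadrant) :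
    ContinuousOn (fun t : ℝ => G t) (Set.Ici 0) :=
  hG.comp (by fun_prop) fun t ht => by simpa using add_mul_I_mem_closedQuadrant ht le_rfl

lemma exists_norm_shift_mul_le (hG : ContinuousOn G closedQuadrant) {ψ : ℝ → ℝ}
    (hψ : HasCompactSupport ψ) :
    ∃ C, ∀ ε ∈ Set.Icc (0 : ℝ) 1, ∀ t ∈ Set.Ioi (0 : ℝ),
      ‖G (t + ε * I) * (ψ t : ℂ)‖ ≤ C * ‖ψ t‖ := by
  have hK : IsCompact (Set.Icc (0 : ℝ) 1 ×ˢ (tsupport ψ ∩ Set.Ici 0)) :=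
    isCompact_Icc.prod (hψ.isCompact.inter_right isClosed_Ici)
  obtain ⟨C, hC⟩ := hK.exists_bound_of_continuousOn (f := fun q : ℝ × ℝ => G (q.2 + q.1 * I))
    (hG.comp (by fun_prop) fun q hq => add_mul_I_mem_closedQuadrant hq.2.2 hq.1.1)
  refine ⟨C, fun ε hε t ht => ?_⟩
  rw [norm_mul, norm_real]
  by_cases hts : t ∈ tsupport ψ
  · exact mul_le_mul_of_nonneg_right (hC (ε, t) ⟨hε, hts, Set.Ioi_subset_Ici_self ht⟩)
      (norm_nonneg _)
  · simp [image_eq_zero_of_notMem_tsupport hts]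

theorem isBoundaryValue_of_continuousOn (hG : ContinuousOn G closedQuadrant) :
    IsBoundaryValue G (halfLineDistr fun t => G t) := by
  intro φ
  obtain ⟨C, hC⟩ := exists_norm_shift_mul_le hG φ.hasCompactSupport
  have hφ : IntegrableOn (fun t => C * ‖φ t‖) (Set.Ioi 0) :=
    ((φ.continuous.integrable_of_hasCompactSupport
      φ.hasCompactSupport).norm.const_mul C).integrableOn
  have hmeas : ∀ ε ∈ Set.Ioc (0 : ℝ) 1, AEStronglyMeasurable
      (fun t : ℝ => G (t + ε * I) * (φ t : ℂ)) (volume.restrict (Set.Ioi 0)) := fun ε hε =>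
    ((hG.comp (by fun_prop) fun t ht => add_mul_I_mem_closedQuadrant (le_of_lt ht) hε.1.le).mul
      (continuous_ofReal.comp φ.continuous).continuousOn).aestronglyMeasurable measurableSet_Ioi
  have hbound : ∀ ε ∈ Set.Ioc (0 : ℝ) 1, ∀ᵐ t : ℝ ∂volume.restrict (Set.Ioi 0),
      ‖G (t + ε * I) * (φ t : ℂ)‖ ≤ C * ‖φ t‖ := fun ε hε =>
    (ae_restrict_mem measurableSet_Ioi).mono (hC ε ⟨hε.1.le, hε.2⟩)
  have hev : ∀ᶠ ε : ℝ in 𝓝[>] 0, ε ∈ Set.Ioc (0 : ℝ) 1 := Ioc_mem_nhdsGT zero_lt_one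
  refine ⟨hev.mono fun ε hε => Integrable.mono' hφ (hmeas ε hε) (hbound ε hε), ?_⟩
  rw [halfLineDistr_apply (continuousOn_ofReal_of_closedQuadrant hG)]
  refine tendsto_integral_filter_of_dominated_convergence _ (hev.mono hmeas) (hev.mono hbound) hφ ?_
  filter_upwards [ae_restrict_mem measurableSet_Ioi] with t ht
  have hvert : ContinuousOn (fun ε : ℝ => G (t + ε * I)) (Set.Ici 0) :=
    hG.comp (by fun_prop) fun ε hε => add_mul_I_mem_closedQuadrant (le_of_lt ht) hε
  have hlim := ((hvert 0 Set.self_mem_Ici).mono Set.Ioi_subset_Ici_self).tendsto.mul_const (φ t : ℂ)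
  simpa [mul_comm] using hlim

end ContinuousBoundary

/-! ### Conjugation and the principal part -/

lemma principalPart_apply (T : Distr) (φ : 𝓓((⊤ : Opens ℝ), ℝ)) :
    principalPart T φ = ((T φ).re : ℂ) := by
  change (1 / 2 : ℝ) • (T φ + conj (T φ)) = _
  rw [real_smul, add_conj]
  push_cast
  ring

lemma pairing_principalPart (T : Distr) (χ : 𝓓((⊤ : Opens ℝ), ℝ)) (z : ℂ) :
    pairing (principalPart T) (expTest χ z) =
      1 / 2 * (pairing T (expTest χ z) + conj (pairing T (expTest χ (conj z)))) := by
  have hexp (t : ℝ) : exp (-(t : ℂ) / conj z) = conj (exp (-(t : ℂ) / z)) := by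
    rw [← exp_conj, map_div₀, map_neg, conj_ofReal]
  have hre : TestFunction.postcompCLM reCLM (expTest χ (conj z)) =
      TestFunction.postcompCLM reCLM (expTest χ z) := by
    ext t
    change ((χ t : ℂ) * exp (-(t : ℂ) / conj z)).re = ((χ t : ℂ) * exp (-(t : ℂ) / z)).re
    rw [hexp, re_ofReal_mul, re_ofReal_mul, conj_re]
  have him : TestFunction.postcompCLM imCLM (expTest χ (conj z)) =
      -TestFunction.postcompCLM imCLM (expTest χ z) := by
    ext t
    change ((χ t : ℂ) * exp (-(t : ℂ) / conj z)).im = -((χ t : ℂ) * exp (-(t : ℂ) / z)).im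
    rw [hexp, im_ofReal_mul, im_ofReal_mul, conj_im, mul_neg]
  simp only [pairing, hre, him, principalPart_apply, re_eq_add_conj, map_neg, map_add, map_mul,
    conj_I]
  ring

theorem HasLaplaceIntegral.principalPart {T : Distr} {z L L' : ℂ} (h : HasLaplaceIntegral T z L)
    (h' : HasLaplaceIntegral T (conj z) L') :
    HasLaplaceIntegral (principalPart T) z (1 / 2 * (L + conj L')) := by
  intro χ hχ
  simp only [pairing_principalPart]
  exact ((h χ hχ).add ((continuous_conj.tendsto _).comp (h' χ hχ))).const_mul _

theorem HasLaplaceBorel.principalPart {T : Distr} {z w w' : ℂ} (h : HasLaplaceBorel T z w)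
    (h' : HasLaplaceBorel T (conj z) w') :
    HasLaplaceBorel (principalPart T) z (1 / 2 * (w + conj w')) := by
  obtain ⟨L, hL, rfl⟩ := h
  obtain ⟨L', hL', rfl⟩ := h'
  refine ⟨_, hL.principalPart hL', ?_⟩
  simp only [map_mul, map_inv₀, conj_conj]
  ring

theorem IsBoundaryValue.re {B : ℂ → ℂ} {T : Distr} (h : IsBoundaryValue B T) :
    IsBoundaryValue (fun t => ((B t).re : ℂ)) (principalPart T) := by
  intro φ
  obtain ⟨hint, hlim⟩ := h φ
  have hre (ε t : ℝ) : ((B (t + ε * I)).re : ℂ) * (φ t : ℂ) =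
      ((B (t + ε * I) * (φ t : ℂ)).re : ℂ) := by
    rw [re_mul_ofReal, ofReal_mul]
  simp only [hre, principalPart_apply]
  refine ⟨hint.mono fun ε hε => hε.re.ofReal, ?_⟩
  refine (((continuous_ofReal.comp continuous_re).tendsto _).comp hlim).congr' ?_
  filter_upwards [hint] with ε hε
  rw [integral_complex_ofReal]
  exact congr_arg _ (reCLM.integral_comp_comm hε).symm

/-! ### Borel sums in the right half-plane -/

lemma differentiableAt_integral_mul_exp_neg {g : ℝ → ℂ} {κ : ℂ} {K : ℝ} {n : ℕ}
    (hg : ContinuousOn g (Set.Ici 0)) (hK : ∀ r, 0 ≤ r → ‖g r‖ ≤ K * r ^ n) (hκ : 0 < κ.re) :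
    DifferentiableAt ℂ (fun κ : ℂ => ∫ r in Set.Ioi (0 : ℝ), g r * exp (-(r * κ))) κ := by
  obtain ⟨c, hc, hcκ⟩ := exists_between hκ
  have hcont := hg.mono Set.Ioi_subset_Ici_self
  refine (hasDerivAt_integral_of_dominated_loc_of_deriv_le
    (F := fun κ (r : ℝ) => g r * exp (-(r * κ)))
    (F' := fun κ (r : ℝ) => g r * (exp (-(r * κ)) * -r))
    (bound := fun r => K * (r ^ (n + 1) * Real.exp (-(c * r))))
    ((isOpen_lt continuous_const continuous_re).mem_nhds hcκ)
    (Eventually.of_forall fun κ =>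
      (hcont.mul (by fun_prop)).aestronglyMeasurable measurableSet_Ioi)
    (integrableOn_mul_exp_neg hg hK hκ)
    ((hcont.mul (by fun_prop)).aestronglyMeasurable measurableSet_Ioi) ?_
    ((integrableOn_pow_mul_exp_neg (n + 1) hc).const_mul K)
    (Eventually.of_forall fun r z _ => ?_)).2.differentiableAt
  · filter_upwards [ae_restrict_mem measurableSet_Ioi] with r hr z hz
    have hr0 : 0 ≤ r := le_of_lt hr
    have hexp : Real.exp (-(r * z.re)) ≤ Real.exp (-(c * r)) := by
      rw [mul_comm c]
      exact Real.exp_le_exp.2 (neg_le_neg (mul_le_mul_of_nonneg_left (le_of_lt hz) hr0))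
    rw [norm_mul, norm_mul, norm_neg, norm_real, Real.norm_of_nonneg hr0, norm_exp, neg_re,
      re_ofReal_mul]
    calc ‖g r‖ * (Real.exp (-(r * z.re)) * r)
        ≤ K * r ^ n * (Real.exp (-(c * r)) * r) :=
          mul_le_mul (hK r hr0) (mul_le_mul_of_nonneg_right hexp hr0) (by positivity)
            ((norm_nonneg _).trans (hK r hr0))
      _ = K * (r ^ (n + 1) * Real.exp (-(c * r))) := by ring
  · have hlin : HasDerivAt (fun κ : ℂ => -((r : ℂ) * κ)) (-(r : ℂ)) z := by
      simpa using ((hasDerivAt_id z).const_mul (r : ℂ)).fun_neg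
    exact hlin.cexp.const_mul _

lemma inv_re_pos {z : ℂ} (hz : 0 < z.re) : 0 < (z⁻¹).re := by
  have hz0 : z ≠ 0 := by rintro rfl; simp at hz
  rw [inv_re]
  exact div_pos hz (normSq_pos.2 hz0)

namespace RealPoles

variable {ι : Type*} (P : RealPoles ι) {β : ℂ}

lemma exists_norm_primitive_ofReal_le :
    ∃ K, ∀ r : ℝ, 0 ≤ r → ‖P.primitive r‖ ≤ K * r ^ 3 := by
  obtain ⟨K, hK⟩ := P.exists_norm_primitive_le
  exact ⟨K, fun r hr => by simpa [abs_of_nonneg hr] using hK r⟩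

lemma continuousOn_primitive_ofReal : ContinuousOn (fun t : ℝ => P.primitive t) (Set.Ici 0) :=
  continuousOn_ofReal_of_closedQuadrant P.continuousOn_primitive

lemma differentiableAt_borelSum (hβ : 0 < β.re) : DifferentiableAt ℂ P.borelSum β := by
  obtain ⟨K, hK⟩ := P.exists_norm_primitive_ofReal_le
  have hβ0 : β ≠ 0 := by rintro rfl; simp at hβ
  have hlaplace := (differentiableAt_integral_mul_exp_neg P.continuousOn_primitive_ofReal hK
    (inv_re_pos hβ)).comp β (differentiableAt_inv hβ0)
  refine ((differentiableAt_inv hβ0).mul hlaplace).congr_of_eventuallyEq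
    (Eventually.of_forall fun z => ?_)
  simp only [borelSum, neg_mul, div_eq_mul_inv, Function.comp_apply, Pi.mul_apply]

/-- The boundary value `P.primitive(t + i0)`, a continuous function. -/
def primitiveDistr : Distr := halfLineDistr fun t => P.primitive t

lemma isBoundaryValue_primitive : IsBoundaryValue P.primitive P.primitiveDistr :=
  isBoundaryValue_of_continuousOn P.continuousOn_primitive

theorem isBoundaryValue_cauchy : IsBoundaryValue P.cauchy (distrDeriv^[3] P.primitiveDistr) := by
  have hsub : {t : ℂ | 0 < t.im} ⊆ P.domain := Set.subset_union_right
  have haxis : Tendsto (fun ε : ℝ => (ε * I : ℂ)) (𝓝[>] 0) (𝓝 0) := by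
    simpa using ((by fun_prop : Continuous fun ε : ℝ => (ε * I : ℂ)).tendsto 0).mono_left
      (nhdsWithin_le_nhds (s := Set.Ioi 0))
  refine (P.isBoundaryValue_primitive.iterate_distrDeriv (P.differentiableOn_primitive.mono hsub)
    3 fun j hj => ?_).congr (P.iteratedDeriv_three_primitive.mono hsub)
  have hcont := (hasDerivAt_iteratedDeriv P.differentiableOn_primitive P.isOpen_domain j
    P.zero_mem_domain).continuousAt.tendsto
  rw [P.iteratedDeriv_primitive_zero hj] at hcont
  exact hcont.comp haxis

theorem hasLaplaceBorel_primitiveDistr (hβ : 0 < β.re) :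
    HasLaplaceBorel P.primitiveDistr β (P.borelSum β) := by
  obtain ⟨K, hK⟩ := P.exists_norm_primitive_ofReal_le
  refine ⟨_, hasLaplaceIntegral_halfLineDistr P.continuousOn_primitive_ofReal ?_, rfl⟩
  simpa only [neg_mul, div_eq_mul_inv] using
    integrableOn_mul_exp_neg P.continuousOn_primitive_ofReal hK (inv_re_pos hβ)

end RealPoles

lemma re_pos_of_mem_borelDisk {R : ℝ} (hR : 0 < R) {z : ℂ} (hz : z ∈ borelDisk R) : 0 < z.re := by
  have hinv : 0 < (z⁻¹).re := (inv_pos.2 hR).trans hz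
  simpa using inv_re_pos hinv

theorem isUpperSum_and_isDistributionalBorelSum {c : ℕ → ℂ} {B Ψ f : ℂ → ℂ} {T : Distr}
    (hB : IsBorelContinuation c B) (hT : IsBoundaryValue B T)
    (hΨ : ∀ β : ℂ, 0 < β.re → HasLaplaceBorel T β (Ψ β))
    (hf : ∀ β : ℂ, 0 < β.re → HasLaplaceBorel (principalPart T) β (f β)) {R : ℝ} (hR : 0 < R) :
    IsUpperSum c Ψ R ∧ IsDistributionalBorelSum c f R :=
  ⟨⟨hR, B, T, hB, hT, fun z hz => hΨ z (re_pos_of_mem_borelDisk hR hz)⟩,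
    hR, B, T, hB, hT, fun z hz => hf z (re_pos_of_mem_borelDisk hR hz)⟩

/-! ### The effective action -/

/-- The boundary value `B(t + i0)` of the Borel transform of `∑ aₙ β^{2n-3}`. -/
def borelDistr : Distr := distrDeriv^[3] borelPoles.primitiveDistr

lemma isBoundaryValue_borelDistr : IsBoundaryValue borelB borelDistr :=
  borelPoles.isBoundaryValue_cauchy.congr (eqOn_borelPoles_cauchy.mono Set.subset_union_right)

lemma hasLaplaceBorel_primitiveDistr {β : ℂ} (hβ : 0 < β.re) :
    HasLaplaceBorel borelPoles.primitiveDistr β (Phi β) :=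
  Phi_eq_borelSum hβ ▸ borelPoles.hasLaplaceBorel_primitiveDistr hβ

lemma hasLaplaceBorel_borelDistr {β : ℂ} (hβ : 0 < β.re) :
    HasLaplaceBorel borelDistr β ((β ^ 3)⁻¹ * Phi β) :=
  (hasLaplaceBorel_primitiveDistr hβ).iterate_distrDeriv 3

lemma differentiableOn_Phi : DifferentiableOn ℂ Phi {β | 0 < β.re} :=
  DifferentiableOn.congr (fun _ hβ =>
    (borelPoles.differentiableAt_borelSum hβ).differentiableWithinAt) fun _ hβ => Phi_eq_borelSum hβ

lemma differentiableOn_inv_cube_mul_Phi :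
    DifferentiableOn ℂ (fun β => (β ^ 3)⁻¹ * Phi β) {β | 0 < β.re} := by
  refine DifferentiableOn.mul (fun β hβ => ?_) differentiableOn_Phi
  have hβ0 : β ≠ 0 := by rintro rfl; simp at hβ
  have hinv : DifferentiableAt ℂ (fun β : ℂ => (β ^ 3)⁻¹) β :=
    (differentiableAt_pow 3).fun_inv (pow_ne_zero 3 hβ0)
  exact hinv.differentiableWithinAt

lemma hasLaplaceBorel_principalPart_borelDistr {β : ℂ} (hβ : 0 < β.re) :
    HasLaplaceBorel (principalPart borelDistr) β
      (1 / 2 * ((β ^ 3)⁻¹ * Phi β + conj (((conj β) ^ 3)⁻¹ * Phi (conj β)))) :=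
  (hasLaplaceBorel_borelDistr hβ).principalPart
    (hasLaplaceBorel_borelDistr (by rwa [conj_re]))

lemma hasLaplaceBorel_principalPart_primitiveDistr {β : ℂ} (hβ : 0 < β.re) :
    HasLaplaceBorel (principalPart borelPoles.primitiveDistr) β
      (1 / 2 * (Phi β + conj (Phi (conj β)))) :=
  (hasLaplaceBorel_primitiveDistr hβ).principalPart
    (hasLaplaceBorel_primitiveDistr (by rwa [conj_re]))

lemma cube_mul_average {β : ℂ} (hβ : β ≠ 0) (w w' : ℂ) :
    β ^ 3 * (1 / 2 * ((β ^ 3)⁻¹ * w + conj (((conj β) ^ 3)⁻¹ * w'))) =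
      1 / 2 * (w + conj w') := by
  simp only [map_mul, map_inv₀, map_pow, conj_conj]
  field_simp

end VacPol

end

theorem mainTheorem3 :
    -- the improper integral defining `Φ(β) = S(β²)` converges for `Re β > 0`
    (∀ β : ℂ, 0 < β.re →
      Tendsto (VacPol.actionPartial (β ^ 2)) atTop (𝓝 (VacPol.Phi β))) ∧
    -- the rotated representation of `Φ`
    (∀ β : ℂ, 0 < β.arg → β.arg < Real.pi / 2 →
      IntegrableOn (VacPol.rotatedIntegrand β) (Set.Ioi 0) ∧
      VacPol.Phi β =
        1 / (8 * (Real.pi : ℂ) ^ 2) * ∫ t in Set.Ioi (0 : ℝ), VacPol.rotatedIntegrand β t) ∧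
    -- `B` is the Borel transform of `∑ aₙ β^{2n-3}`
    VacPol.IsBorelContinuation VacPol.seriesShifted VacPol.borelB ∧
    -- `T = B(t + i0)` exists, and `PP(B(t))` is the boundary value of `Re B`
    ∃ T : VacPol.Distr, VacPol.IsBoundaryValue VacPol.borelB T ∧
      VacPol.IsBoundaryValue (fun t => ((VacPol.borelB t).re : ℂ)) (VacPol.principalPart T) ∧
      ∃ F f : ℂ → ℂ,
        -- the Laplace-Borel integral of `B(t + i0)` is `F`, the one of `PP(B(t))` is `f`
        (∀ β : ℂ, 0 < β.re → VacPol.HasLaplaceBorel T β (F β)) ∧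
        DifferentiableOn ℂ F {β | 0 < β.re} ∧
        (∀ β : ℂ, 0 < β.re → F β = (β ^ 3)⁻¹ * VacPol.Phi β) ∧
        (∀ β : ℂ, 0 < β.re → VacPol.HasLaplaceBorel (VacPol.principalPart T) β (f β)) ∧
        (∀ β : ℂ, 0 < β.re →
          f β = 1 / 2 * ((β ^ 3)⁻¹ * VacPol.Phi β +
            conj (((conj β) ^ 3)⁻¹ * VacPol.Phi (conj β)))) ∧
        -- distributional Borel summability of `∑ aₙ β^{2n-3}`
        (∀ R : ℝ, 0 < R →
          VacPol.IsUpperSum VacPol.seriesShifted (fun β => (β ^ 3)⁻¹ * VacPol.Phi β) R ∧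
          VacPol.IsDistributionalBorelSum VacPol.seriesShifted f R) ∧
        -- distributional Borel summability of `∑ aₙ β^{2n}`
        (∀ R : ℝ, 0 < R →
          VacPol.IsUpperSum VacPol.seriesFull VacPol.Phi R ∧
          VacPol.IsDistributionalBorelSum VacPol.seriesFull (fun β => β ^ 3 * f β) R) ∧
        (∀ β : ℂ, 0 < β.re →
          β ^ 3 * f β = 1 / 2 * (VacPol.Phi β + conj (VacPol.Phi (conj β)))) := by
  have hf : ∀ β : ℂ, 0 < β.re → VacPol.HasLaplaceBorel (VacPol.principalPart VacPol.borelDistr) β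
      (1 / 2 * ((β ^ 3)⁻¹ * VacPol.Phi β + conj (((conj β) ^ 3)⁻¹ * VacPol.Phi (conj β)))) :=
    fun _ => VacPol.hasLaplaceBorel_principalPart_borelDistr
  have hcube : ∀ β : ℂ, 0 < β.re → β ^ 3 * (1 / 2 * ((β ^ 3)⁻¹ * VacPol.Phi β +
      conj (((conj β) ^ 3)⁻¹ * VacPol.Phi (conj β)))) =
        1 / 2 * (VacPol.Phi β + conj (VacPol.Phi (conj β))) :=
    fun _ hβ => VacPol.cube_mul_average (by rintro rfl; simp at hβ) _ _
  exact ⟨fun _ => VacPol.tendsto_actionPartial,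
    fun _ hpos hlt => ⟨VacPol.integrableOn_rotatedIntegrand ⟨hpos, by linarith [Real.pi_pos]⟩,
      VacPol.Phi_eq_integral_rotatedIntegrand ⟨hpos, hlt⟩⟩,
    VacPol.isBorelContinuation_borelB, VacPol.borelDistr, VacPol.isBoundaryValue_borelDistr,
    VacPol.isBoundaryValue_borelDistr.re, _, _, fun _ => VacPol.hasLaplaceBorel_borelDistr,
    VacPol.differentiableOn_inv_cube_mul_Phi, fun _ _ => rfl, hf, fun _ _ => rfl,
    fun _ => VacPol.isUpperSum_and_isDistributionalBorelSum VacPol.isBorelContinuation_borelB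
      VacPol.isBoundaryValue_borelDistr (fun _ => VacPol.hasLaplaceBorel_borelDistr) hf,
    fun _ => VacPol.isUpperSum_and_isDistributionalBorelSum
      VacPol.isBorelContinuation_borelPoles_primitive VacPol.borelPoles.isBoundaryValue_primitive
      (fun _ => VacPol.hasLaplaceBorel_primitiveDistr) fun _ hβ => (hcube _ hβ).symm ▸
        VacPol.hasLaplaceBorel_principalPart_primitiveDistr hβ,
    hcube⟩
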